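/- **Setting.** Let $\mathcal A$ be a finite alphabet, $\mathbb B(r)=[-r,r]^D\subset\mathbb Z^D$, $\sigma^{z}$ the shift $\sigma^z(\mathbf a)_y=a_{y+z}$, $\mathbb E$ the set of unit steps $(0,\dots,0,\pm1,0,\dots,0)$. Let $\mathfrak A\subset\mathcal A^{\mathbb Z^D}$ be a subshift. A block on $\mathbb B(z,r)=z+\mathbb B(r)$ is admissible if it is the restriction (after translation to $\mathbb B(r)$) of an element of $\mathfrak A$. For a configuration $\mathbf a$ let $\mathcal F_{\mathbf a}(z)\in\mathbb N\cup\{\infty\}$ be the largest $r$ such that $\mathbf a_{\mathbb B(z,r)}$ is admissible, $\mathbb G_r(\mathbf a)=\{z:\mathcal F_{\mathbf a}(z)\ge r\}$, and $\widetilde{\mathfrak A}=\{\mathbf a:\sup_z\mathcal F_{\mathbf a}(z)=\infty\}$; $\mathbf a$ is defective if $\mathbf a\in\widetilde{\mathfrak A}\setminus\mathfrak A$. All coefficient groups are discrete. A ($G$-valued) cocycle is a continuous $C:\mathbb Z^D\times\mathfrak A\to G$ with $C(y+z,\mathbf x)=C(y,\sigma^z\mathbf x)\,C(z,\mathbf x)$;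 $C\approx C'$ means $C'(z,\mathbf x)=b(\sigma^z\mathbf x)C(z,\mathbf x)b(\mathbf x)^{-1}$ for a continuous $b:\mathfrak A\to G$. $H^1_{dy}(\mathfrak A,G)$ is the set of $\approx$-classes; for abelian $G$ it may equally be taken to be the group of cocycles modulo those cohomologous to a homomorphism $\mathbb Z^D\to G$ (the statement holds for both versions). $C$ is locally determined with radius $r$ if for each $e\in\mathbb E$, $C(e,\mathbf x)=c(e,\mathbf x_{\mathbb B(r)})$ depends only on $\mathbf x_{\mathbb B(r)}$; every cocycle is so for some $r$. For a trail $\zeta=(z_0,\dots,z_N)$ (consecutive points differ by unit steps) in $\mathbb G_r(\mathbf a)$ put $$c(\zeta,\mathbf a)=c(z_N-z_{N-1},\mathbf a_{\mathbb B(z_{N-1},r)})\cdots c(z_1-z_0,\mathbf a_{\mathbb B(z_0,r)}).$$ Let $\pi_1(\mathbb Y,y)$ be the set of closed trails in $\mathbb Y$ based at $y$ modulo trail homotopy in $\mathbb Y$ (generated by changing the middle vertex of two consecutive steps and by deleting or inserting back-and-forth steps). For $s>r$, $\zeta\mapsto c(\zeta,\mathbf a)$ induces the residue $\mathrm{Res}^s_{\mathbf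 a}C:\pi_1(\mathbb G_s(\mathbf a),y)\to G$. A proper base ray for $\mathbf a$ is an infinite trail $\omega$ tending to infinity which for every $s$ is eventually contained in $\mathbb G_s(\mathbf a)$. Let $\pi_1(\mathbb G_\infty(\mathbf a),\omega)=\varprojlim_s\pi_1(\mathbb G_s(\mathbf a),\omega)$, base points being moved along $\omega$. For $\zeta$ in it let $\mathrm{res}_{\mathbf a}(C,\zeta)$ be $c(\zeta',\mathbf a)$, where $C$ is locally determined with radius $r$ and $\zeta'$ represents $\zeta$ in $\mathbb G_s(\mathbf a)$ for some $s>r$ (well defined if $G$ is abelian, and up to conjugacy in general). We say that $\mathbf a$ has a $G$-pole (along $\omega$) if $\mathrm{res}_{\mathbf a}(C,\zeta)\ne e$ for some $G$-valued cocycle $C$ and some $\zeta$. A $G$-valued cocycle $C^*$ is fundamental if for every group $H$ and every $H$-valued cocycle $C$ there is a homomorphism $\psi:G\to H$ with $C\approx\psi\circ C^*$. **Proposition.** Let $\Phi$ be a cellular automaton on $\mathcal A^{\mathbb Z^D}$ of radius $R>0$ with $\Phi(\mathfrak A)\subseteq\mathfrak A$. Put $\Phi_*C(z,\mathbf x)=C(z,\Phi(\mathbf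 x))$. Let $\mathbf a\in\widetilde{\mathfrak A}$ and $\mathbf b=\Phi(\mathbf a)$. (a) Let $C$ be a cocycle (with values in any group) which is locally determined with radius $r>0$. Then $\mathbb G_{R+r}(\mathbf a)\subseteq\mathbb G_r(\mathbf b)$, $\Phi_*C$ is locally determined with radius $R+r$, and $C(\zeta,\mathbf b)=\Phi_*C(\zeta,\mathbf a)$ for every trail $\zeta$ in $\mathbb G_{R+r}(\mathbf a)$ (evaluated with local rules of radius $r$ and $R+r$ respectively). Consequently, for all $s>r$, $\mathrm{Res}_{\mathbf b}^{s}C\circ\iota=\mathrm{Res}_{\mathbf a}^{R+s}(\Phi_*C)$, where $\iota:\pi_1(\mathbb G_{R+s}(\mathbf a),y)\to\pi_1(\mathbb G_s(\mathbf b),y)$ is induced by inclusion. (b) If $\Phi_*:H^1_{dy}(\mathfrak A,G)\to H^1_{dy}(\mathfrak A,G)$ is surjective, then every $G$-pole is $\Phi$-persistent: if $\mathbf a$ has a $G$-pole along $\omega$, then for all $t\in\mathbb N$, $\Phi^t(\mathbf a)$ is defective and has a $G$-pole along $\omega$. Suppose $\mathfrak A$ has a fundamental cocycle $C^*$ with values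 in an abelian group $G^*$, and let $\mathrm{res}^*_{\mathbf a}(\zeta)=\mathrm{res}_{\mathbf a}(C^*,\zeta)$, $\zeta\in\pi_1(\mathbb G_\infty(\mathbf a),\omega)$. (c) If $H$ is any abelian group and $\mathbf a$ has an $H$-pole along $\omega$, then $\mathrm{res}^*_{\mathbf a}$ is nontrivial on $\pi_1(\mathbb G_\infty(\mathbf a),\omega)$. (d) There are $\varphi\in\mathrm{End}(G^*)$ with $\Phi_*(\varepsilon\circ C^*)\approx\varepsilon\circ\varphi\circ C^*$ for all $\varepsilon\in\mathrm{End}(G^*)$. For any such $\varphi$ and any proper base ray $\omega$ for $\mathbf a$ (which is then one for $\mathbf b$), $\mathrm{res}^*_{\mathbf b}\circ\iota=\varphi\circ\mathrm{res}^*_{\mathbf a}$, where $\iota:\pi_1(\mathbb G_\infty(\mathbf a),\omega)\to\pi_1(\mathbb G_\infty(\mathbf b),\omega)$ is induced by the inclusions $\mathbb G_{R+s}(\mathbf a)\subseteq\mathbb G_s(\mathbf b)$. Hence, if $\varphi^n\circ\mathrm{res}^*_{\mathbf a}$ is nontrivial for all $n\in\mathbb N$, then the defect of $\mathbf a$ is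 $\Phi$-persistent, i.e. $\Phi^t(\mathbf a)$ is defective for all $t\in\mathbb N$. (e) If such a $\varphi$ is a monomorphism, then every pole is $\Phi$-persistent: if $\mathbf a$ has an $H$-pole along $\omega$ for some group $H$, then for all $t\in\mathbb N$, $\Phi^t(\mathbf a)$ is defective and has a $G^*$-pole along $\omega$. -/

import Mathlib

universe u v

/-! ### Configurations, subshifts, cellular automata -/

/-- Configurations `a = [a_z]` on the lattice `ℤ^D` with letters in `A`. -/
abbrev Config (D : ℕ) (A : Type*) : Type _ := (Fin D → ℤ) → A

/-- The shift `σ^v`, `σ^v(a)_z = a_{z+v}`. -/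
def shift {D : ℕ} {A : Type*} (v : Fin D → ℤ) (a : Config D A) : Config D A := fun z => a (z + v)

/-- The box `𝔹(r) = [-r..r]^D`. -/
def box (D r : ℕ) : Set (Fin D → ℤ) := {i | ∀ k, |i k| ≤ (r : ℤ)}

theorem box_mono {D r s : ℕ} (h : r ≤ s) : box D r ⊆ box D s := fun i hi k =>
  (hi k).trans (by exact_mod_cast h)

/-- The set `𝔼` of unit steps `(0,…,0,±1,0,…,0)`. -/
def unitSteps (D : ℕ) : Set (Fin D → ℤ) := {e | ∃ k, e = Pi.single k 1 ∨ e = -Pi.single k 1}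

theorem unitSteps_neg {D : ℕ} {e : Fin D → ℤ} (he : e ∈ unitSteps D) : -e ∈ unitSteps D := by
  obtain ⟨k, rfl | rfl⟩ := he
  · exact ⟨k, Or.inr rfl⟩
  · exact ⟨k, Or.inl (neg_neg _)⟩

theorem unitSteps_box {D : ℕ} {e : Fin D → ℤ} (he : e ∈ unitSteps D) : e ∈ box D 1 := by
  obtain ⟨k, rfl | rfl⟩ := he <;> intro j <;> by_cases h : j = k <;> simp [h]

theorem box_add {D r s : ℕ} {i j : Fin D → ℤ} (hi : i ∈ box D r) (hj : j ∈ box D s) :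
    i + j ∈ box D (r + s) := fun k => by
  have h1 := hi k
  have h2 := hj k
  have h3 := abs_add_le (i k) (j k)
  push_cast
  simp only [Pi.add_apply]
  linarith

theorem unitSteps_finite (D : ℕ) : (unitSteps D).Finite := by
  have h : unitSteps D ⊆ Set.range (fun k : Fin D => (Pi.single k 1 : Fin D → ℤ)) ∪
      Set.range (fun k : Fin D => -(Pi.single k 1 : Fin D → ℤ)) := by
    rintro e ⟨k, rfl | rfl⟩
    · exact Or.inl ⟨k, rfl⟩
    · exact Or.inr ⟨k, rfl⟩
  exact ((Set.finite_range _).union (Set.finite_range _)).subset h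

/-- A subshift: a closed, shift-invariant set of configurations. -/
structure Subshift (D : ℕ) (A : Type*) [TopologicalSpace A] where
  carrier : Set (Config D A)
  isClosed : IsClosed carrier
  shift_mem : ∀ (v : Fin D → ℤ) (a : Config D A), a ∈ carrier → shift v a ∈ carrier

/-- A cellular automaton: a continuous self-map of `A^(ℤ^D)` commuting with all shifts. -/
structure CellularAutomaton (D : ℕ) (A : Type*) [TopologicalSpace A] where
  toFun : Config D A → Config D A
  continuous : Continuous toFun
  comm_shift : ∀ (v : Fin D → ℤ) (a : Config D A), toFun (shift v a) = shift v (toFun a)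

/-- `Φ` has radius `R`: the letter `Φ(a)_0` depends only on the block `a_{𝔹(R)}`. -/
def CellularAutomaton.HasRadius {D : ℕ} {A : Type*} [TopologicalSpace A]
    (Φ : CellularAutomaton D A) (R : ℕ) : Prop :=
  ∀ a a' : Config D A, (∀ i ∈ box D R, a i = a' i) → Φ.toFun a 0 = Φ.toFun a' 0

theorem CellularAutomaton.HasRadius.apply {D : ℕ} {A : Type*} [TopologicalSpace A]
    {Φ : CellularAutomaton D A} {R : ℕ} (h : Φ.HasRadius R) {a a' : Config D A} {z : Fin D → ℤ}
    (haa : ∀ i ∈ box D R, a (i + z) = a' (i + z)) : Φ.toFun a z = Φ.toFun a' z := by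
  have h1 := h (shift z a) (shift z a') haa
  rw [Φ.comm_shift, Φ.comm_shift] at h1
  simpa [shift] using h1

/-- `𝔄` is (weakly) `Φ`-invariant: `Φ(𝔄) ⊆ 𝔄`. -/
def Subshift.IsInvariant {D : ℕ} {A : Type*} [TopologicalSpace A] (𝔄 : Subshift D A)
    (Φ : CellularAutomaton D A) : Prop :=
  ∀ a ∈ 𝔄.carrier, Φ.toFun a ∈ 𝔄.carrier

/-! ### Admissible blocks and the defect field -/

/-- The block `a_{𝔹(z,r)}` is `𝔄`-admissible, i.e. belongs to `𝔄_(r)` (as a block on `𝔹(r)`). -/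
def Subshift.Admissible {D : ℕ} {A : Type*} [TopologicalSpace A] (𝔄 : Subshift D A)
    (a : Config D A) (z : Fin D → ℤ) (r : ℕ) : Prop :=
  ∃ x ∈ 𝔄.carrier, ∀ i ∈ box D r, x i = a (i + z)

/-- The defect field: the largest `r` (possibly `∞`) such that `a_{𝔹(z,r)}` is admissible. -/
noncomputable def Subshift.defectField {D : ℕ} {A : Type*} [TopologicalSpace A]
    (𝔄 : Subshift D A) (a : Config D A) (z : Fin D → ℤ) : ℕ∞ :=
  ⨆ (r : ℕ) (_ : 𝔄.Admissible a z r), (r : ℕ∞)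

/-- The unflawed region `𝔾_r(a)` of range `r`: the sites where the defect field is at least `r`. -/
def Subshift.unflawed {D : ℕ} {A : Type*} [TopologicalSpace A] (𝔄 : Subshift D A)
    (a : Config D A) (r : ℕ) : Set (Fin D → ℤ) :=
  {z | (r : ℕ∞) ≤ 𝔄.defectField a z}

/-- The set `𝔄~` of configurations whose defect field is unbounded. -/
def Subshift.slightlyDefective {D : ℕ} {A : Type*} [TopologicalSpace A] (𝔄 : Subshift D A) :
    Set (Config D A) :=
  {a | ⨆ z, 𝔄.defectField a z = ⊤}

/-- `a` is defective: it lies in `𝔄~` but not in `𝔄`. -/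
def Subshift.IsDefective {D : ℕ} {A : Type*} [TopologicalSpace A] (𝔄 : Subshift D A)
    (a : Config D A) : Prop :=
  a ∈ 𝔄.slightlyDefective ∧ a ∉ 𝔄.carrier

section
variable {D : ℕ} {A : Type*} [TopologicalSpace A] (𝔄 : Subshift D A)

theorem Subshift.Admissible.anti {𝔄 : Subshift D A} {a : Config D A} {z : Fin D → ℤ} {r s : ℕ}
    (hrs : r ≤ s) (h : 𝔄.Admissible a z s) : 𝔄.Admissible a z r := by
  obtain ⟨x, hx, hxa⟩ := h
  exact ⟨x, hx, fun i hi => hxa i (box_mono hrs hi)⟩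

theorem Subshift.mem_unflawed_iff {a : Config D A} {z : Fin D → ℤ} {r : ℕ} (hr : 0 < r) :
    z ∈ 𝔄.unflawed a r ↔ 𝔄.Admissible a z r := by
  constructor
  · intro h
    by_contra hn
    have h1 : 𝔄.defectField a z ≤ ((r - 1 : ℕ) : ℕ∞) := by
      unfold Subshift.defectField
      refine iSup₂_le fun s hs => ?_
      have : s < r := by
        by_contra hsr
        exact hn (hs.anti (not_lt.mp hsr))
      exact_mod_cast (by omega : s ≤ r - 1)
    have h2 : (r : ℕ∞) ≤ ((r - 1 : ℕ) : ℕ∞) := le_trans h h1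
    have h3 : r ≤ r - 1 := by exact_mod_cast h2
    omega
  · intro h
    exact le_iSup₂ (f := fun (r : ℕ) (_ : 𝔄.Admissible a z r) => (r : ℕ∞)) r h

theorem Subshift.unflawed_anti (a : Config D A) {r s : ℕ} (h : r ≤ s) :
    𝔄.unflawed a s ⊆ 𝔄.unflawed a r := fun _ hz =>
  by
  have h1 : (r : ℕ∞) ≤ (s : ℕ∞) := by exact_mod_cast h
  exact h1.trans hz

variable {𝔄} in
/-- A cellular automaton of radius `R` shrinks the unflawed regions by at most `R`. -/
theorem Subshift.unflawed_subset {Φ : CellularAutomaton D A} {R : ℕ} (hR : Φ.HasRadius R)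
    (hΦ : 𝔄.IsInvariant Φ) (a : Config D A) (s : ℕ) :
    𝔄.unflawed a (R + s) ⊆ 𝔄.unflawed (Φ.toFun a) s := by
  intro z hz
  rcases Nat.eq_zero_or_pos s with rfl | hs
  · simp [Subshift.unflawed]
  rw [Subshift.mem_unflawed_iff _ (by omega)] at hz ⊢
  obtain ⟨x, hx, hxa⟩ := hz
  refine ⟨Φ.toFun x, hΦ x hx, fun i hi => ?_⟩
  have h1 : Φ.toFun x i = Φ.toFun (shift z a) i :=
    hR.apply fun j hj => hxa (j + i) (box_add hj hi)
  rw [h1, Φ.comm_shift]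
  rfl

end

/-! ### Dynamical cocycles -/

/-- The shift as a self-map of a subshift. -/
def Subshift.shiftMap {D : ℕ} {A : Type*} [TopologicalSpace A] (𝔄 : Subshift D A)
    (v : Fin D → ℤ) (a : 𝔄.carrier) : 𝔄.carrier :=
  ⟨shift v a.1, 𝔄.shift_mem v a.1 a.2⟩

/-- A continuous dynamical cocycle on `𝔄` with values in the discrete group `G`
(continuity into a discrete space is local constancy). -/
@[ext]
structure Cocycle {D : ℕ} {A : Type*} [TopologicalSpace A] (𝔄 : Subshift D A)
    (G : Type*) [Group G] where
  toFun : (Fin D → ℤ) → 𝔄.carrier → G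
  locConst : ∀ z, IsLocallyConstant (toFun z)
  cocycle_eq : ∀ (y z : Fin D → ℤ) (a : 𝔄.carrier),
    toFun (y + z) a = toFun y (𝔄.shiftMap z a) * toFun z a

/-- `C ≈ C'`: there is a continuous transfer function `b` with
`C'(z,a) = b(σ^z a) C(z,a) b(a)⁻¹`. -/
def Cocycle.Cohomologous {D : ℕ} {A : Type*} [TopologicalSpace A] {𝔄 : Subshift D A}
    {G : Type*} [Group G] (C C' : Cocycle 𝔄 G) : Prop :=
  ∃ b : 𝔄.carrier → G, IsLocallyConstant b ∧
    ∀ (z : Fin D → ℤ) (a : 𝔄.carrier), C'.toFun z a = b (𝔄.shiftMap z a) * C.toFun z a * (b a)⁻¹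

/-- `C` is locally determined with radius `r`: for every unit step `e`, `C(e,a)` is a function of
the block `a_{𝔹(r)}`. -/
def Cocycle.IsLocallyDetermined {D : ℕ} {A : Type*} [TopologicalSpace A] {𝔄 : Subshift D A}
    {G : Type*} [Group G] (C : Cocycle 𝔄 G) (r : ℕ) : Prop :=
  ∀ e ∈ unitSteps D, ∀ a a' : 𝔄.carrier, (∀ i ∈ box D r, a.1 i = a'.1 i) →
    C.toFun e a = C.toFun e a'

open Classical in
/-- The value `c(e, a_{𝔹(z,r)})` of the local rule of `C` of radius `r` at the block of `a` around
`z`: it is `C(e,x)` for any `x ∈ 𝔄` whose block on `𝔹(r)` is that block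
(and the junk value `1` if the block is not admissible). -/
noncomputable def Cocycle.localRule {D : ℕ} {A : Type*} [TopologicalSpace A] {𝔄 : Subshift D A}
    {G : Type*} [Group G] (C : Cocycle 𝔄 G) (r : ℕ) (e : Fin D → ℤ) (a : Config D A)
    (z : Fin D → ℤ) : G :=
  if h : 𝔄.Admissible a z r then C.toFun e ⟨h.choose, h.choose_spec.1⟩ else 1

section
variable {D : ℕ} {A : Type*} [TopologicalSpace A] {𝔄 : Subshift D A} {G H : Type*} [Group G]
  [Group H]

theorem Cocycle.localRule_eq {C : Cocycle 𝔄 G} {r : ℕ} (hC : C.IsLocallyDetermined r)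
    {e : Fin D → ℤ} (he : e ∈ unitSteps D) {a : Config D A} {z : Fin D → ℤ} (x : 𝔄.carrier)
    (hx : ∀ i ∈ box D r, x.1 i = a (i + z)) : C.localRule r e a z = C.toFun e x := by
  have h : 𝔄.Admissible a z r := ⟨x.1, x.2, hx⟩
  rw [Cocycle.localRule, dif_pos h]
  exact hC e he _ _ fun i hi => (h.choose_spec.2 i hi).trans (hx i hi).symm

theorem Subshift.continuous_shiftMap (v : Fin D → ℤ) : Continuous (𝔄.shiftMap v) := by
  refine Continuous.subtype_mk (continuous_pi fun z => ?_) _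
  exact (continuous_apply (z + v)).comp continuous_subtype_val

theorem Cocycle.map_zero (C : Cocycle 𝔄 G) (a : 𝔄.carrier) : C.toFun 0 a = 1 := by
  have h := C.cocycle_eq 0 0 a
  have h0 : 𝔄.shiftMap 0 a = a := by
    apply Subtype.ext
    funext z
    simp [Subshift.shiftMap, shift]
  rw [h0, add_zero] at h
  simpa using h

/-- Every continuous cocycle with values in a discrete group is locally determined. -/
theorem Cocycle.exists_isLocallyDetermined [DiscreteTopology A] [Finite A] (C : Cocycle 𝔄 G) :
    ∃ r, C.IsLocallyDetermined r := by
  have : CompactSpace 𝔄.carrier := isCompact_iff_compactSpace.mp 𝔄.isClosed.isCompact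
  have key : ∀ e : Fin D → ℤ, ∃ r : ℕ, ∀ a a' : 𝔄.carrier,
      (∀ i ∈ box D r, a.1 i = a'.1 i) → C.toFun e a = C.toFun e a' := by
    intro e
    let K : Set (𝔄.carrier × 𝔄.carrier) := {p | C.toFun e p.1 ≠ C.toFun e p.2}
    let S : ℕ → Set (𝔄.carrier × 𝔄.carrier) := fun r => {p | ∀ i ∈ box D r, p.1.1 i = p.2.1 i}
    have hK : IsCompact K := by
      apply IsClosed.isCompact
      have h1 : IsLocallyConstant (fun p : 𝔄.carrier × 𝔄.carrier =>
          (C.toFun e p.1, C.toFun e p.2)) :=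
        ((C.locConst e).comp_continuous continuous_fst).prodMk
          ((C.locConst e).comp_continuous continuous_snd)
      exact ⟨h1 {q | ¬ q.1 ≠ q.2}⟩
    have hS : ∀ r, IsClosed (S r) := by
      intro r
      simp only [S, Set.ofPred_forall]
      refine isClosed_iInter fun i => isClosed_iInter fun _ => ?_
      exact isClosed_eq
        ((continuous_apply i).comp (continuous_subtype_val.comp continuous_fst))
        ((continuous_apply i).comp (continuous_subtype_val.comp continuous_snd))
    have hdir : Directed (· ⊇ ·) S := by
      intro r s
      refine ⟨max r s, fun p hp i hi => hp i (box_mono (le_max_left _ _) hi),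
        fun p hp i hi => hp i (box_mono (le_max_right _ _) hi)⟩
    have hemp : K ∩ ⋂ r, S r = ∅ := by
      ext p
      simp only [Set.mem_inter_iff, Set.mem_iInter, Set.mem_empty_iff_false, iff_false, not_and]
      intro hp hall
      apply hp
      have : p.1 = p.2 := by
        apply Subtype.ext
        funext i
        refine hall (∑ k, (i k).natAbs) i fun k => ?_
        have h1 : (i k).natAbs ≤ ∑ k, (i k).natAbs :=
          Finset.single_le_sum (f := fun k => (i k).natAbs) (fun _ _ => Nat.zero_le _)
            (Finset.mem_univ k)
        rw [Int.abs_eq_natAbs]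
        exact_mod_cast h1
      rw [this]
    obtain ⟨r, hr⟩ := hK.elim_directed_family_closed S hS hemp hdir
    refine ⟨r, fun a a' haa => ?_⟩
    by_contra hne
    have : (a, a') ∈ K ∩ S r := ⟨hne, haa⟩
    rw [hr] at this
    exact this
  choose f hf using key
  obtain ⟨M, hM⟩ := ((unitSteps_finite D).image f).bddAbove
  exact ⟨M, fun e he a a' haa =>
    hf e a a' fun i hi => haa i (box_mono (hM ⟨e, he, rfl⟩) hi)⟩

/-- The induced cocycle `Φ_* C (z,a) = C(z, Φ(a))`. -/
def Cocycle.pullback {Φ : CellularAutomaton D A} (hΦ : 𝔄.IsInvariant Φ) (C : Cocycle 𝔄 G) :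
    Cocycle 𝔄 G where
  toFun z a := C.toFun z ⟨Φ.toFun a.1, hΦ a.1 a.2⟩
  locConst z := (C.locConst z).comp_continuous
    (Continuous.subtype_mk (Φ.continuous.comp continuous_subtype_val) _)
  cocycle_eq y z a := by
    rw [C.cocycle_eq]
    congr 2
    apply Subtype.ext
    exact (Φ.comm_shift z a.1).symm

/-- The cocycle `ψ ∘ C` for a group homomorphism `ψ`. -/
def Cocycle.comp (ψ : G →* H) (C : Cocycle 𝔄 G) : Cocycle 𝔄 H where
  toFun z a := ψ (C.toFun z a)
  locConst z := (C.locConst z).comp ψ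
  cocycle_eq y z a := by rw [C.cocycle_eq, map_mul]

/-- The cocycle `C(z,a) = h(z)` of a group homomorphism `h : ℤ^D → G`. -/
def Cocycle.ofHom (𝔄 : Subshift D A) (h : Multiplicative (Fin D → ℤ) →* G) : Cocycle 𝔄 G where
  toFun z _ := h (Multiplicative.ofAdd z)
  locConst _ := IsLocallyConstant.const _
  cocycle_eq y z _ := by rw [ofAdd_add, map_mul]

/-- A cocycle is trivial if it is cohomologous to a homomorphism. -/
def Cocycle.IsTrivial (C : Cocycle 𝔄 G) : Prop :=
  ∃ h : Multiplicative (Fin D → ℤ) →* G, C.Cohomologous (Cocycle.ofHom 𝔄 h)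

theorem Cocycle.Cohomologous.refl (C : Cocycle 𝔄 G) : C.Cohomologous C :=
  ⟨fun _ => 1, IsLocallyConstant.const _, fun z a => by simp⟩

theorem Cocycle.Cohomologous.symm {C C' : Cocycle 𝔄 G} (h : C.Cohomologous C') :
    C'.Cohomologous C := by
  obtain ⟨b, hb, h⟩ := h
  exact ⟨fun a => (b a)⁻¹, hb.comp _, fun z a => by rw [h]; group⟩

theorem Cocycle.Cohomologous.trans {C C' C'' : Cocycle 𝔄 G} (h : C.Cohomologous C')
    (h' : C'.Cohomologous C'') : C.Cohomologous C'' := by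
  obtain ⟨b, hb, h⟩ := h
  obtain ⟨b', hb', h'⟩ := h'
  exact ⟨fun a => b' a * b a, hb'.comp₂ hb _, fun z a => by rw [h', h]; group⟩

theorem Cocycle.Cohomologous.pullback {Φ : CellularAutomaton D A} (hΦ : 𝔄.IsInvariant Φ)
    {C C' : Cocycle 𝔄 G} (h : C.Cohomologous C') :
    (C.pullback hΦ).Cohomologous (C'.pullback hΦ) := by
  obtain ⟨b, hb, h⟩ := h
  refine ⟨fun a => b ⟨Φ.toFun a.1, hΦ a.1 a.2⟩, hb.comp_continuous
    (Continuous.subtype_mk (Φ.continuous.comp continuous_subtype_val) _), fun z a => ?_⟩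
  have h1 : 𝔄.shiftMap z ⟨Φ.toFun a.1, hΦ a.1 a.2⟩ =
      ⟨Φ.toFun (𝔄.shiftMap z a).1, hΦ _ (𝔄.shiftMap z a).2⟩ :=
    Subtype.ext (Φ.comm_shift z a.1).symm
  have h2 := h z ⟨Φ.toFun a.1, hΦ a.1 a.2⟩
  rw [h1] at h2
  exact h2

/-- Cohomology of cocycles is an equivalence relation. -/
instance Cocycle.cohomologousSetoid (𝔄 : Subshift D A) (G : Type*) [Group G] :
    Setoid (Cocycle 𝔄 G) :=
  ⟨Cocycle.Cohomologous, Cocycle.Cohomologous.refl, Cocycle.Cohomologous.symm,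
    Cocycle.Cohomologous.trans⟩

/-- For a group `G` that need not be abelian: the set of cohomology classes of cocycles. -/
def DynClasses (𝔄 : Subshift D A) (G : Type*) [Group G] : Type _ :=
  Quotient (Cocycle.cohomologousSetoid 𝔄 G)

/-- The map induced by `Φ` on the set of cohomology classes. -/
def DynClasses.map {Φ : CellularAutomaton D A} (hΦ : 𝔄.IsInvariant Φ) (G : Type*) [Group G] :
    DynClasses 𝔄 G → DynClasses 𝔄 G :=
  Quotient.map (Cocycle.pullback hΦ) fun _ _ h => Cocycle.Cohomologous.pullback hΦ h

end

/-! ### The cohomology group for abelian coefficients -/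

section
variable {D : ℕ} {A : Type*} [TopologicalSpace A] (𝔄 : Subshift D A) (G : Type*) [CommGroup G]

/-- Cocycles with values in an abelian group form a group under pointwise multiplication. -/
instance Cocycle.instCommGroup : CommGroup (Cocycle 𝔄 G) where
  mul C C' := ⟨fun z a => C.toFun z a * C'.toFun z a,
    fun z => (C.locConst z).comp₂ (C'.locConst z) (· * ·),
    fun y z a => by rw [C.cocycle_eq, C'.cocycle_eq, mul_mul_mul_comm]⟩
  one := ⟨fun _ _ => 1, fun _ => IsLocallyConstant.const _, fun _ _ _ => (mul_one 1).symm⟩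
  inv C := ⟨fun z a => (C.toFun z a)⁻¹, fun z => (C.locConst z).comp (·⁻¹),
    fun y z a => by rw [C.cocycle_eq, mul_inv]⟩
  mul_assoc _ _ _ := Cocycle.ext (funext₂ fun _ _ => mul_assoc _ _ _)
  one_mul _ := Cocycle.ext (funext₂ fun _ _ => one_mul _)
  mul_one _ := Cocycle.ext (funext₂ fun _ _ => mul_one _)
  inv_mul_cancel _ := Cocycle.ext (funext₂ fun _ _ => inv_mul_cancel _)
  mul_comm _ _ := Cocycle.ext (funext₂ fun _ _ => mul_comm _ _)

/-- The subgroup of trivial cocycles (those cohomologous to a homomorphism). -/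
def trivialCocycles : Subgroup (Cocycle 𝔄 G) where
  carrier := {C | C.IsTrivial}
  one_mem' := ⟨1, fun _ => 1, IsLocallyConstant.const _, fun z a => by
    change _ = 1 * (1 : G) * 1⁻¹
    simp [Cocycle.ofHom]⟩
  mul_mem' := by
    rintro C C' ⟨h, b, hb, e⟩ ⟨h', b', hb', e'⟩
    refine ⟨h * h', fun a => b a * b' a, hb.comp₂ hb' (· * ·), fun z a => ?_⟩
    have e1 := congrArg₂ (· * ·) (e z a) (e' z a)
    change h _ * h' _ = _ at e1
    change h _ * h' _ = _ * (C.toFun z a * C'.toFun z a) * _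
    rw [e1, mul_inv]
    simp only [mul_comm, mul_left_comm, mul_assoc]
  inv_mem' := by
    rintro C ⟨h, b, hb, e⟩
    refine ⟨h⁻¹, fun a => (b a)⁻¹, hb.comp (·⁻¹), fun z a => ?_⟩
    have e1 := congrArg (·⁻¹) (e z a)
    change (h _)⁻¹ = _ at e1
    change (h _)⁻¹ = _ * (C.toFun z a)⁻¹ * _
    rw [e1]
    simp only [mul_inv, inv_inv]

/-- The first dynamical cohomology group of `𝔄` with coefficients in the abelian group `G`:
cocycles modulo trivial cocycles. -/
abbrev DynCohomology : Type _ := Cocycle 𝔄 G ⧸ trivialCocycles 𝔄 G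

variable {𝔄}

/-- `Φ_*` as an endomorphism of the group of cocycles. -/
def Cocycle.pullbackHom {Φ : CellularAutomaton D A} (hΦ : 𝔄.IsInvariant Φ) :
    Cocycle 𝔄 G →* Cocycle 𝔄 G where
  toFun := Cocycle.pullback hΦ
  map_one' := rfl
  map_mul' _ _ := rfl

/-- The endomorphism `Φ_*` of the first dynamical cohomology group. -/
def DynCohomology.map {Φ : CellularAutomaton D A} (hΦ : 𝔄.IsInvariant Φ) :
    DynCohomology 𝔄 G →* DynCohomology 𝔄 G :=
  QuotientGroup.map _ _ (Cocycle.pullbackHom G hΦ) fun _ hC =>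
    let ⟨h, hC⟩ := hC
    ⟨h, Cocycle.Cohomologous.pullback hΦ hC⟩

end

/-- A cocycle with values in `G` is fundamental if every cocycle with values in any group `H` is
cohomologous to its image under some homomorphism `G → H`. -/
def Cocycle.IsFundamental {D : ℕ} {A : Type*} [TopologicalSpace A] {𝔄 : Subshift D A}
    {G : Type u} [Group G] (Cs : Cocycle 𝔄 G) : Prop :=
  ∀ (H : Type u) [Group H] (C : Cocycle 𝔄 H), ∃ ψ : G →* H, C.Cohomologous (Cs.comp ψ)

/-- `φ ∈ End(G)` is an endomorphism induced by `Φ` through the cocycle `Cs`: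
`Φ_*(ε ∘ Cs) ≈ (ε ∘ φ) ∘ Cs` for all `ε ∈ End(G)`. -/
def Cocycle.IsInducedEnd {D : ℕ} {A : Type*} [TopologicalSpace A] {𝔄 : Subshift D A}
    {Φ : CellularAutomaton D A} (hΦ : 𝔄.IsInvariant Φ) {G : Type*} [CommGroup G]
    (Cs : Cocycle 𝔄 G) (φ : G →* G) : Prop :=
  ∀ ε : G →* G, ((Cs.comp ε).pullback hΦ).Cohomologous (Cs.comp (ε.comp φ))

/-! ### Trails, trail homotopy and the fundamental group -/

/-- The nearest neighbour graph on `ℤ^D`. -/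
def latticeGraph (D : ℕ) : SimpleGraph (Fin D → ℤ) where
  Adj x y := y - x ∈ unitSteps D
  symm := ⟨fun x y h => by simpa using unitSteps_neg h⟩
  loopless := ⟨fun x h => by
    rw [sub_self] at h
    obtain ⟨k, hk | hk⟩ := h
    · simpa using congrFun hk k
    · simpa using congrFun hk k⟩

/-- A trail in `Y ⊆ ℤ^D` from `x` to `y`: a walk all of whose vertices lie in `Y`. -/
abbrev Trail {D : ℕ} (Y : Set (Fin D → ℤ)) (x y : Y) : Type :=
  ((latticeGraph D).induce Y).Walk x y

/-- Elementary homotopies of trails in `Y` (endpoints fixed): replace the middle vertex of two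
consecutive steps, or remove a back-and-forth pair of steps. -/
inductive ElemHomotopic {D : ℕ} {Y : Set (Fin D → ℤ)} :
    ∀ {x y : Y}, Trail Y x y → Trail Y x y → Prop
  | square {x u v v' w y : Y} (p : Trail Y x u)
      (h1 : ((latticeGraph D).induce Y).Adj u v) (h2 : ((latticeGraph D).induce Y).Adj v w)
      (h1' : ((latticeGraph D).induce Y).Adj u v') (h2' : ((latticeGraph D).induce Y).Adj v' w)
      (q : Trail Y w y) :
      ElemHomotopic (p.append (.cons h1 (.cons h2 q))) (p.append (.cons h1' (.cons h2' q)))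
  | spur {x u v y : Y} (p : Trail Y x u)
      (h1 : ((latticeGraph D).induce Y).Adj u v) (h2 : ((latticeGraph D).induce Y).Adj v u)
      (q : Trail Y u y) :
      ElemHomotopic (p.append (.cons h1 (.cons h2 q))) (p.append q)

/-- Homotopy of trails in `Y`: the equivalence relation generated by elementary homotopies. -/
def trailSetoid {D : ℕ} (Y : Set (Fin D → ℤ)) (x y : Y) : Setoid (Trail Y x y) :=
  Relation.EqvGen.setoid ElemHomotopic

/-- (The underlying set of) the fundamental group `π₁(Y,x)`: homotopy classes of closed trails
in `Y` based at `x`. -/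
def LoopClass {D : ℕ} (Y : Set (Fin D → ℤ)) (x : Y) : Type := Quotient (trailSetoid Y x x)

/-- A trail in `Y` seen as a trail in a larger set. -/
def Trail.incl {D : ℕ} {Y Z : Set (Fin D → ℤ)} (h : Y ⊆ Z) {x y : Y} (p : Trail Y x y) :
    Trail Z ⟨x.1, h x.2⟩ ⟨y.1, h y.2⟩ :=
  SimpleGraph.Walk.map ⟨fun z : Y => (⟨z.1, h z.2⟩ : Z), fun hadj => hadj⟩ p

theorem ElemHomotopic.conj {D : ℕ} {Y Z : Set (Fin D → ℤ)} (h : Y ⊆ Z) {x y : Y}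
    {p p' : Trail Y x y} (hp : ElemHomotopic p p') {x' y' : Z} (q : Trail Z x' ⟨x.1, h x.2⟩)
    {q' : Trail Z ⟨y.1, h y.2⟩ y'} :
    ElemHomotopic (q.append ((Trail.incl h p).append q')) (q.append ((Trail.incl h p').append q')) := by
  cases hp with
  | @square u v v' w _ p h1 h2 h1' h2' r =>
    have := ElemHomotopic.square (q.append (Trail.incl h p)) (v := ⟨v.1, h v.2⟩)
      (v' := ⟨v'.1, h v'.2⟩) (w := ⟨w.1, h w.2⟩) h1 h2 h1' h2' ((Trail.incl h r).append q')
    simpa only [Trail.incl, SimpleGraph.Walk.map_append, SimpleGraph.Walk.map_cons,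
      ← SimpleGraph.Walk.append_assoc, SimpleGraph.Walk.cons_append] using this
  | @spur u v _ p h1 h2 r =>
    have := ElemHomotopic.spur (q.append (Trail.incl h p)) (u := ⟨u.1, h u.2⟩)
      (v := ⟨v.1, h v.2⟩) h1 h2 ((Trail.incl h r).append q')
    simpa only [Trail.incl, SimpleGraph.Walk.map_append, SimpleGraph.Walk.map_cons,
      ← SimpleGraph.Walk.append_assoc, SimpleGraph.Walk.cons_append] using this

/-- Given `Y ⊆ Z` and a trail `q` in `Z` from `x'` to the point `x` of `Y`: the map
`π₁(Y,x) → π₁(Z,x')`, `[p] ↦ [q ⋆ p ⋆ q⁻¹]`. -/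
def LoopClass.push {D : ℕ} {Y Z : Set (Fin D → ℤ)} (h : Y ⊆ Z) {x : Y} {x' : Z}
    (q : Trail Z x' ⟨x.1, h x.2⟩) : LoopClass Y x → LoopClass Z x' :=
  Quotient.map (sa := trailSetoid Y x x) (sb := trailSetoid Z x' x')
    (fun p => q.append ((Trail.incl h p).append q.reverse)) (by
      intro p p' hpp
      change Relation.EqvGen _ _ _ at hpp
      change Relation.EqvGen _ _ _
      induction hpp with
      | rel p p' hp => exact Relation.EqvGen.rel _ _ (hp.conj h q)
      | refl => exact Relation.EqvGen.refl _
      | symm _ _ _ ih => exact Relation.EqvGen.symm _ _ ih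
      | trans _ _ _ _ _ ih1 ih2 => exact Relation.EqvGen.trans _ _ _ ih1 ih2)

theorem LoopClass.push_push {D : ℕ} {X Y Z : Set (Fin D → ℤ)} (h : X ⊆ Y) (h' : Y ⊆ Z) {x : X}
    {x' : Y} {x'' : Z} (q : Trail Y x' ⟨x.1, h x.2⟩) (q' : Trail Z x'' ⟨x'.1, h' x'.2⟩)
    (ζ : LoopClass X x) : LoopClass.push h' q' (LoopClass.push h q ζ) =
      LoopClass.push (h.trans h') (q'.append (Trail.incl h' q)) ζ := by
  induction ζ using Quotient.inductionOn with
  | h p =>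
    refine congrArg (Quotient.mk (trailSetoid Z x'' x'')) ?_
    simp only [Trail.incl, SimpleGraph.Walk.map_append, SimpleGraph.Walk.map_map,
      ← SimpleGraph.Walk.append_assoc, SimpleGraph.Walk.reverse_append,
      SimpleGraph.Walk.reverse_map]
    erw [← SimpleGraph.Walk.append_assoc]
    rfl

/-- The map `π₁(Y,x) → π₁(Z,x)` induced by an inclusion `Y ⊆ Z`. -/
def LoopClass.incl {D : ℕ} {Y Z : Set (Fin D → ℤ)} (h : Y ⊆ Z) {x : Y} :
    LoopClass Y x → LoopClass Z ⟨x.1, h x.2⟩ :=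
  LoopClass.push h .nil

/-! ### Residues -/

section
variable {D : ℕ} {A : Type*} [TopologicalSpace A] {𝔄 : Subshift D A} {G : Type*} [Group G]

/-- The value `c(ζ,a) = c(z'_N, a_{𝔹(z_{N-1},r)}) ⋯ c(z'_2, a_{𝔹(z_1,r)}) · c(z'_1, a_{𝔹(z_0,r)})`
of the local rule of `C` of radius `r` along a trail `ζ = (z_0,…,z_N)`, where
`z'_n = z_n - z_{n-1}`. Later steps stand on the left, as the cocycle equation dictates. -/
noncomputable def Cocycle.along (C : Cocycle 𝔄 G) (r : ℕ) (a : Config D A)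
    {Y : Set (Fin D → ℤ)} : ∀ {x y : Y}, Trail Y x y → G
  | _, _, .nil => 1
  | x, _, .cons (v := v) _ p => Cocycle.along C r a p * C.localRule r (v.1 - x.1) a x.1

theorem Cocycle.along_append (C : Cocycle 𝔄 G) (r : ℕ) (a : Config D A) {Y : Set (Fin D → ℤ)}
    {x y z : Y} (p : Trail Y x y) (q : Trail Y y z) :
    C.along r a (p.append q) = C.along r a q * C.along r a p := by
  induction p with
  | nil => simp [Cocycle.along]
  | cons h p ih => simp [Cocycle.along, ih, mul_assoc]

/-- Two consecutive steps starting at a site of the unflawed region of range `s > r` have the value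
that the cocycle takes at an element of `𝔄`. -/
theorem Cocycle.localRule_two {C : Cocycle 𝔄 G} {r s : ℕ} (hC : C.IsLocallyDetermined r)
    (hs : r < s) {a : Config D A} {u v w : Fin D → ℤ} (h1 : v - u ∈ unitSteps D)
    (h2 : w - v ∈ unitSteps D) (x : 𝔄.carrier) (hx : ∀ i ∈ box D s, x.1 i = a (i + u)) :
    C.localRule r (w - v) a v * C.localRule r (v - u) a u = C.toFun (w - u) x := by
  have e1 : C.localRule r (v - u) a u = C.toFun (v - u) x :=
    Cocycle.localRule_eq hC h1 x fun i hi => hx i (box_mono hs.le hi)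
  have e2 : C.localRule r (w - v) a v = C.toFun (w - v) (𝔄.shiftMap (v - u) x) := by
    refine Cocycle.localRule_eq hC h2 _ fun i hi => ?_
    have := hx (i + (v - u)) (box_mono hs (box_add hi (unitSteps_box h1)))
    simpa [Subshift.shiftMap, shift, add_assoc] using this
  rw [e1, e2, ← C.cocycle_eq, sub_add_sub_cancel]

theorem Cocycle.along_elemHomotopic {C : Cocycle 𝔄 G} {r s : ℕ} (hC : C.IsLocallyDetermined r)
    (hs : r < s) {a : Config D A} {x y : 𝔄.unflawed a s} {p p' : Trail (𝔄.unflawed a s) x y}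
    (h : ElemHomotopic p p') : C.along r a p = C.along r a p' := by
  have adm : ∀ u : 𝔄.unflawed a s, ∃ x : 𝔄.carrier, ∀ i ∈ box D s, x.1 i = a (i + u.1) := by
    intro u
    obtain ⟨x, hx, hxa⟩ := (𝔄.mem_unflawed_iff (by omega)).mp u.2
    exact ⟨⟨x, hx⟩, hxa⟩
  cases h with
  | @square u v v' w _ p h1 h2 h1' h2' q =>
    obtain ⟨x, hx⟩ := adm u
    have e1 := Cocycle.localRule_two hC hs (u := u.1) (v := v.1) (w := w.1) h1 h2 x hx
    have e2 := Cocycle.localRule_two hC hs (u := u.1) (v := v'.1) (w := w.1) h1' h2' x hx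
    simp only [Cocycle.along_append, Cocycle.along, mul_assoc]
    rw [← mul_assoc (C.localRule r (w.1 - v.1) a v.1), ← mul_assoc (C.localRule r (w.1 - v'.1) a v'.1),
      e1, e2]
  | @spur u v _ p h1 h2 q =>
    obtain ⟨x, hx⟩ := adm u
    have e1 := Cocycle.localRule_two hC hs (u := u.1) (v := v.1) (w := u.1) h1 h2 x hx
    simp only [Cocycle.along_append, Cocycle.along, mul_assoc]
    rw [← mul_assoc (C.localRule r (u.1 - v.1) a v.1), e1, sub_self, Cocycle.map_zero, one_mul]

/-- The residue of range `s` of `a`: for a cocycle `C` which is locally determined with radius `r`,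
and `s > r`, the map `π₁(𝔾_s(a),x) → G` which sends the class of a closed trail `ζ` to `c(ζ,a)`. -/
noncomputable def Cocycle.residue (C : Cocycle 𝔄 G) {r : ℕ} (hC : C.IsLocallyDetermined r) {s : ℕ}
    (hs : r < s) (a : Config D A) {x : 𝔄.unflawed a s} : LoopClass (𝔄.unflawed a s) x → G :=
  Quotient.lift (s := trailSetoid _ x x) (C.along r a) (by
    intro p p' hpp
    change Relation.EqvGen _ _ _ at hpp
    induction hpp with
    | rel p p' h => exact Cocycle.along_elemHomotopic hC hs h
    | refl => rfl
    | symm _ _ _ ih => exact ih.symm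
    | trans _ _ _ _ _ ih1 ih2 => exact ih1.trans ih2)

end

/-! ### Proper base rays and the projective fundamental group -/

/-- The segment from index `n` to index `m` of an infinite trail `ω` which lies in `Y` from index
`n` on. -/
def raySegment {D : ℕ} {ω : ℕ → Fin D → ℤ} (hadj : ∀ n, (latticeGraph D).Adj (ω n) (ω (n + 1)))
    {Y : Set (Fin D → ℤ)} {n : ℕ} (hY : ∀ k ≥ n, ω k ∈ Y) {m : ℕ} (hm : n ≤ m) :
    Trail Y ⟨ω n, hY n le_rfl⟩ ⟨ω m, hY m hm⟩ :=
  Nat.leRec (motive := fun k hk => Trail Y ⟨ω n, hY n le_rfl⟩ ⟨ω k, hY k hk⟩)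
    .nil (fun k _ p => p.concat (hadj k)) hm

theorem raySegment_append {D : ℕ} {ω : ℕ → Fin D → ℤ}
    (hadj : ∀ n, (latticeGraph D).Adj (ω n) (ω (n + 1))) {Y Z : Set (Fin D → ℤ)} (h : Y ⊆ Z)
    {n m k : ℕ} (hZ : ∀ k ≥ n, ω k ∈ Z) (hY : ∀ k ≥ m, ω k ∈ Y) (hnm : n ≤ m) (hmk : m ≤ k) :
    (raySegment hadj hZ hnm).append (Trail.incl h (raySegment hadj hY hmk)) =
      raySegment hadj hZ (hnm.trans hmk) := by
  induction k, hmk using Nat.le_induction with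
  | base =>
    rw [raySegment.eq_def hadj hY, Nat.leRec_self]
    exact SimpleGraph.Walk.append_nil _
  | succ k hmk ih =>
    have a1 : ((latticeGraph D).induce Y).Adj ⟨ω k, hY k hmk⟩
        ⟨ω (k + 1), hY _ (Nat.le_succ_of_le hmk)⟩ := hadj k
    have a2 : ((latticeGraph D).induce Z).Adj ⟨ω k, hZ k (hnm.trans hmk)⟩
        ⟨ω (k + 1), hZ _ (hnm.trans (Nat.le_succ_of_le hmk))⟩ := hadj k
    have e1 : raySegment hadj hY (Nat.le_succ_of_le hmk) = (raySegment hadj hY hmk).concat a1 :=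
      Nat.leRec_succ _ _ hmk
    have e2 : raySegment hadj hZ (hnm.trans (Nat.le_succ_of_le hmk)) =
        (raySegment hadj hZ (hnm.trans hmk)).concat a2 :=
      Nat.leRec_succ _ _ (hnm.trans hmk)
    rw [e1, e2, ← ih, SimpleGraph.Walk.concat_eq_append, SimpleGraph.Walk.concat_eq_append,
      ← SimpleGraph.Walk.append_assoc, Trail.incl, SimpleGraph.Walk.map_append]
    rfl

/-- `ω` is a proper base ray for `a`: an infinite trail which tends to infinity and which is
eventually contained in the unflawed region of every range. -/
structure IsProperRay {D : ℕ} {A : Type*} [TopologicalSpace A] (𝔄 : Subshift D A)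
    (a : Config D A) (ω : ℕ → Fin D → ℤ) : Prop where
  adj : ∀ n, (latticeGraph D).Adj (ω n) (ω (n + 1))
  tendsto : Filter.Tendsto ω Filter.atTop Filter.cofinite
  eventually_unflawed : ∀ s, ∃ N, ∀ n ≥ N, ω n ∈ 𝔄.unflawed a s

section
variable {D : ℕ} {A : Type*} [TopologicalSpace A] {𝔄 : Subshift D A} {a : Config D A}
  {ω : ℕ → Fin D → ℤ}

open Classical in
/-- The index after which the ray stays in the unflawed region of range `s`. -/
noncomputable def IsProperRay.start (hω : IsProperRay 𝔄 a ω) (s : ℕ) : ℕ :=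
  Nat.find (hω.eventually_unflawed s)

theorem IsProperRay.mem_of_start_le (hω : IsProperRay 𝔄 a ω) {s n : ℕ} (hn : hω.start s ≤ n) :
    ω n ∈ 𝔄.unflawed a s := by
  classical
  exact Nat.find_spec (hω.eventually_unflawed s) n hn

theorem IsProperRay.start_le (hω : IsProperRay 𝔄 a ω) {s N : ℕ}
    (h : ∀ n ≥ N, ω n ∈ 𝔄.unflawed a s) : hω.start s ≤ N := by
  classical
  exact Nat.find_min' (hω.eventually_unflawed s) h

theorem IsProperRay.start_mono (hω : IsProperRay 𝔄 a ω) {s t : ℕ} (h : s ≤ t) :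
    hω.start s ≤ hω.start t :=
  hω.start_le fun _ hn => 𝔄.unflawed_anti a h (hω.mem_of_start_le hn)

/-- The base point on the ray in the unflawed region of range `s`. -/
noncomputable def IsProperRay.base (hω : IsProperRay 𝔄 a ω) (s : ℕ) : 𝔄.unflawed a s :=
  ⟨ω (hω.start s), hω.mem_of_start_le le_rfl⟩

/-- `π₁(𝔾_s(a),ω)`: the fundamental group of the unflawed region of range `s`, based on `ω`. -/
abbrev IsProperRay.LoopClassAt (hω : IsProperRay 𝔄 a ω) (s : ℕ) : Type :=
  LoopClass (𝔄.unflawed a s) (hω.base s)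

/-- The canonical map `π₁(𝔾_t(a),ω) → π₁(𝔾_s(a),ω)` for `s ≤ t`, given by the inclusion
and the segment of `ω` between the base points. -/
noncomputable def IsProperRay.bond (hω : IsProperRay 𝔄 a ω) {s t : ℕ} (h : s ≤ t) :
    hω.LoopClassAt t → hω.LoopClassAt s :=
  LoopClass.push (𝔄.unflawed_anti a h) 
    (raySegment hω.adj (fun _ hk => hω.mem_of_start_le hk) (hω.start_mono h))

/-- (The underlying set of) the projective fundamental group `π₁(𝔾_∞(a),ω)`: the inverse limit of
the `π₁(𝔾_s(a),ω)` as `s → ∞`. -/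
structure IsProperRay.ProjPi1 (hω : IsProperRay 𝔄 a ω) : Type where
  proj : ∀ s, hω.LoopClassAt s
  compat : ∀ s, hω.bond (Nat.le_succ s) (proj (s + 1)) = proj s

/-- The projective residue `res_a(C,ζ) = C(ζ,a)`: represent `ζ ∈ π₁(𝔾_∞(a),ω)` by a closed trail in
an unflawed region whose range exceeds a radius of `C`, and evaluate a local rule of `C` along it.
(The least radius is used. For abelian coefficients the value does not depend on such choices; in
general it is determined up to conjugation, so that its being trivial is well defined.) -/
noncomputable def IsProperRay.res [DiscreteTopology A] [Finite A] (hω : IsProperRay 𝔄 a ω)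
    {G : Type*} [Group G] (C : Cocycle 𝔄 G) (ζ : hω.ProjPi1) : G :=
  open Classical in
  C.residue (Nat.find_spec C.exists_isLocallyDetermined) (Nat.lt_succ_self _) a (ζ.proj _)

/-- A proper base ray for `a` is one for `Φ(a)`. -/
theorem IsProperRay.image {Φ : CellularAutomaton D A} {R : ℕ} (hω : IsProperRay 𝔄 a ω)
    (hR : Φ.HasRadius R) (hΦ : 𝔄.IsInvariant Φ) : IsProperRay 𝔄 (Φ.toFun a) ω where
  adj := hω.adj
  tendsto := hω.tendsto
  eventually_unflawed s := by
    obtain ⟨N, hN⟩ := hω.eventually_unflawed (R + s)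
    exact ⟨N, fun n hn => Subshift.unflawed_subset hR hΦ a s (hN n hn)⟩

theorem IsProperRay.start_image_le {Φ : CellularAutomaton D A} {R : ℕ} (hω : IsProperRay 𝔄 a ω)
    (hR : Φ.HasRadius R) (hΦ : 𝔄.IsInvariant Φ) (s : ℕ) :
    (hω.image hR hΦ).start s ≤ hω.start (R + s) :=
  (hω.image hR hΦ).start_le fun _ hn =>
    Subshift.unflawed_subset hR hΦ a s (hω.mem_of_start_le hn)

/-- The map `π₁(𝔾_{R+s}(a),ω) → π₁(𝔾_s(Φ(a)),ω)` induced by the inclusion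
`𝔾_{R+s}(a) ⊆ 𝔾_s(Φ(a))`. -/
noncomputable def IsProperRay.imageMapAt {Φ : CellularAutomaton D A} {R : ℕ}
    (hω : IsProperRay 𝔄 a ω) (hR : Φ.HasRadius R) (hΦ : 𝔄.IsInvariant Φ) (s : ℕ) :
    hω.LoopClassAt (R + s) → (hω.image hR hΦ).LoopClassAt s :=
  LoopClass.push (Subshift.unflawed_subset hR hΦ a s)
    (raySegment hω.adj (fun _ hk => (hω.image hR hΦ).mem_of_start_le hk)
      (hω.start_image_le hR hΦ s))

/-- The map `π₁(𝔾_∞(a),ω) → π₁(𝔾_∞(Φ(a)),ω)` induced by the inclusions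
`𝔾_{R+s}(a) ⊆ 𝔾_s(Φ(a))`. -/
noncomputable def IsProperRay.imageMap {Φ : CellularAutomaton D A} {R : ℕ}
    (hω : IsProperRay 𝔄 a ω) (hR : Φ.HasRadius R) (hΦ : 𝔄.IsInvariant Φ) (ζ : hω.ProjPi1) :
    (hω.image hR hΦ).ProjPi1 where
  proj s := hω.imageMapAt hR hΦ s (ζ.proj (R + s))
  compat s := by
    rw [← ζ.compat (R + s)]
    unfold IsProperRay.imageMapAt IsProperRay.bond
    erw [LoopClass.push_push, LoopClass.push_push]
    congr 1
    erw [raySegment_append, raySegment_append]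

/-- `a` has a (projective) `G`-pole (along the proper base ray `ω`): the residue is nontrivial. -/
def HasPole [DiscreteTopology A] [Finite A] (𝔄 : Subshift D A) (G : Type*) [Group G]
    (a : Config D A) (ω : ℕ → Fin D → ℤ) : Prop :=
  ∃ (hω : IsProperRay 𝔄 a ω) (C : Cocycle 𝔄 G) (ζ : hω.ProjPi1), hω.res C ζ ≠ 1

end

/-- The defect of `a` is `Φ`-persistent: `Φ^t(a)` is defective for all `t`. -/
def IsPersistent {D : ℕ} {A : Type*} [TopologicalSpace A] (𝔄 : Subshift D A)
    (Φ : CellularAutomaton D A) (a : Config D A) : Prop :=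
  ∀ t : ℕ, 𝔄.IsDefective (Φ.toFun^[t] a)

/-!
Around a site of `𝔾_s(a)` the configuration `a` looks like an element of `𝔄`, so every identity
between cocycles on `𝔄` becomes an identity between their local rules there, and hence, multiplied
up, an identity between their values along trails. In this way the images `Φ_* C` and `ψ ∘ C`
translate into operations on residues, while a transfer function or a change of base point only
conjugates them. A pole of `Φ_* C` at `a` is therefore a pole of `C` at `Φ(a)`; and since a cocycle
has trivial residues along every closed trail when `a ∈ 𝔄`, a pole certifies a defect. A fundamental
cocycle detects all poles, and its residues evolve under `Φ` by the endomorphism `φ`.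
-/

/-! ### Realizing blocks by elements of the subshift -/

section
variable {D : ℕ}

theorem exists_mem_box (i : Fin D → ℤ) : ∃ r, i ∈ box D r := by
  refine ⟨Finset.univ.sup fun k => (i k).natAbs, fun k => ?_⟩
  rw [Int.abs_eq_natAbs]
  exact_mod_cast Finset.le_sup (f := fun k => (i k).natAbs) (Finset.mem_univ k)

variable {A X : Type*} [TopologicalSpace A] {𝔄 : Subshift D A} {a : Config D A}

/-- The element `x` of `𝔄` realizes the block of `a` on `𝔹(z,r)`: the restriction of `x` to `𝔹(r)`
is the translate of `a_{𝔹(z,r)}`. Such an `x` witnesses admissibility. -/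
def Subshift.Realizes (x : 𝔄.carrier) (a : Config D A) (z : Fin D → ℤ) (r : ℕ) : Prop :=
  ∀ i ∈ box D r, x.1 i = a (i + z)

theorem Subshift.Realizes.anti {x : 𝔄.carrier} {z : Fin D → ℤ} {r s : ℕ} (hrs : r ≤ s)
    (hx : Realizes x a z s) : Realizes x a z r :=
  fun i hi => hx i (box_mono hrs hi)

theorem Subshift.Realizes.shiftMap {x : 𝔄.carrier} {u v : Fin D → ℤ} {r s : ℕ}
    (hx : Realizes x a u s) (huv : v - u ∈ unitSteps D) (hrs : r < s) :
    Realizes (𝔄.shiftMap (v - u) x) a v r := fun i hi => by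
  have := hx (i + (v - u)) (box_mono hrs (box_add hi (unitSteps_box huv)))
  simpa only [Subshift.shiftMap, shift, add_assoc, sub_add_cancel] using this

theorem Subshift.Realizes.image {Φ : CellularAutomaton D A} {R : ℕ} (hR : Φ.HasRadius R)
    (hΦ : 𝔄.IsInvariant Φ) {x : 𝔄.carrier} {z : Fin D → ℤ} {r : ℕ}
    (hx : Realizes x a z (R + r)) :
    Realizes (⟨Φ.toFun x.1, hΦ x.1 x.2⟩ : 𝔄.carrier) (Φ.toFun a) z r := fun i hi =>
  calc Φ.toFun x.1 i = Φ.toFun (shift z a) i := hR.apply fun j hj => hx (j + i) (box_add hj hi)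
    _ = Φ.toFun a (i + z) := congrFun (Φ.comm_shift z a) i

theorem Subshift.exists_realizes {s : ℕ} (hs : 0 < s) (u : 𝔄.unflawed a s) :
    ∃ x : 𝔄.carrier, Realizes x a u s :=
  let ⟨x, hx, hxa⟩ := (𝔄.mem_unflawed_iff hs).mp u.2
  ⟨⟨x, hx⟩, hxa⟩

/-- The function `b` on `𝔄` depends only on the block on `𝔹(r)`. A cocycle is locally determined
with radius `r` if its values at all unit steps are such functions. -/
def Subshift.DependsOnBox (b : 𝔄.carrier → X) (r : ℕ) : Prop :=
  ∀ x x' : 𝔄.carrier, (∀ i ∈ box D r, x.1 i = x'.1 i) → b x = b x'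

theorem Subshift.DependsOnBox.mono {b : 𝔄.carrier → X} {r s : ℕ} (hb : DependsOnBox b r)
    (hrs : r ≤ s) : DependsOnBox b s :=
  fun x x' hxx' => hb x x' fun i hi => hxx' i (box_mono hrs hi)

theorem Subshift.DependsOnBox.eq_of_realizes {b : 𝔄.carrier → X} {r : ℕ}
    (hb : DependsOnBox b r) {x x' : 𝔄.carrier} {z : Fin D → ℤ} (hx : Realizes x a z r)
    (hx' : Realizes x' a z r) : b x = b x' :=
  hb x x' fun i hi => (hx i hi).trans (hx' i hi).symm

theorem Subshift.exists_dependsOnBox [CompactSpace A] [T2Space A] {b : 𝔄.carrier → X}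
    (hb : IsLocallyConstant b) : ∃ r, DependsOnBox b r := by
  have : CompactSpace 𝔄.carrier := isCompact_iff_compactSpace.mp 𝔄.isClosed.isCompact
  let agree (r : ℕ) : Set (𝔄.carrier × 𝔄.carrier) := {p | ∀ i ∈ box D r, p.1.1 i = p.2.1 i}
  have agree_closed (r : ℕ) : IsClosed (agree r) := by
    simp only [agree, Set.ofPred_forall]
    exact isClosed_biInter fun i _ => isClosed_eq
      ((continuous_apply i).comp (continuous_subtype_val.comp continuous_fst))
      ((continuous_apply i).comp (continuous_subtype_val.comp continuous_snd))
  have agree_directed : Directed (· ⊇ ·) agree := fun r s =>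
    ⟨max r s, fun p hp i hi => hp i (box_mono (le_max_left _ _) hi),
      fun p hp i hi => hp i (box_mono (le_max_right _ _) hi)⟩
  have eq_of_agree {p : 𝔄.carrier × 𝔄.carrier} (hp : p ∈ ⋂ r, agree r) : p.1 = p.2 :=
    Subtype.ext <| funext fun i =>
      let ⟨r, hr⟩ := exists_mem_box i
      Set.mem_iInter.mp hp r i hr
  have isOpen_eq : IsOpen {p : 𝔄.carrier × 𝔄.carrier | b p.1 = b p.2} :=
    ((hb.comp_continuous continuous_fst).prodMk (hb.comp_continuous continuous_snd))
      (Set.diagonal X)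
  obtain ⟨r, hr⟩ := exists_subset_nhds_of_compactSpace agree_directed agree_closed
    fun p hp => isOpen_eq.mem_nhds (congrArg b (eq_of_agree hp))
  exact ⟨r, fun x x' hxx' => hr (a := (x, x')) hxx'⟩

end

/-! ### Local rules -/

section
variable {D : ℕ} {A : Type*} [TopologicalSpace A] {𝔄 : Subshift D A} {a : Config D A}
  {G H : Type*} [Group G] [Group H] {C C' : Cocycle 𝔄 G} {r r' s : ℕ}

theorem Cocycle.IsLocallyDetermined.mono (hC : C.IsLocallyDetermined r) (hrs : r ≤ s) :
    C.IsLocallyDetermined s :=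
  fun e he => Subshift.DependsOnBox.mono (hC e he) hrs

theorem Cocycle.IsLocallyDetermined.comp (hC : C.IsLocallyDetermined r) (ψ : G →* H) :
    (C.comp ψ).IsLocallyDetermined r :=
  fun e he x x' hxx' => congrArg ψ (hC e he x x' hxx')

theorem Cocycle.IsLocallyDetermined.mul {G : Type*} [CommGroup G] {C C' : Cocycle 𝔄 G}
    (hC : C.IsLocallyDetermined r) (hC' : C'.IsLocallyDetermined r) :
    (C * C').IsLocallyDetermined r :=
  fun e he x x' hxx' => congrArg₂ (· * ·) (hC e he x x' hxx') (hC' e he x x' hxx')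

theorem Cocycle.IsLocallyDetermined.pullback {Φ : CellularAutomaton D A} {R : ℕ}
    (hR : Φ.HasRadius R) (hΦ : 𝔄.IsInvariant Φ) (hC : C.IsLocallyDetermined r) :
    (C.pullback hΦ).IsLocallyDetermined (R + r) :=
  fun e he _ _ hxx' => hC e he _ _ fun _ hi => hR.apply fun _ hj => hxx' _ (box_add hj hi)

theorem Cocycle.isLocallyDetermined_ofHom (f : Multiplicative (Fin D → ℤ) →* G) (r : ℕ) :
    (Cocycle.ofHom 𝔄 f).IsLocallyDetermined r :=
  fun _ _ _ _ _ => rfl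

theorem Cocycle.localRule_radius (hC : C.IsLocallyDetermined r) (hC' : C.IsLocallyDetermined r')
    (hs : r < s) (hs' : r' < s) (u : 𝔄.unflawed a s) {e : Fin D → ℤ} (he : e ∈ unitSteps D) :
    C.localRule r e a u = C.localRule r' e a u := by
  obtain ⟨x, hx⟩ := Subshift.exists_realizes (Nat.zero_lt_of_lt hs) u
  rw [Cocycle.localRule_eq hC he x (hx.anti hs.le), Cocycle.localRule_eq hC' he x (hx.anti hs'.le)]

theorem Cocycle.localRule_comp (C : Cocycle 𝔄 G) (ψ : G →* H) (r : ℕ) (e : Fin D → ℤ)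
    (a : Config D A) (z : Fin D → ℤ) : (C.comp ψ).localRule r e a z = ψ (C.localRule r e a z) := by
  unfold Cocycle.localRule
  split_ifs
  · rfl
  · exact (map_one ψ).symm

theorem Cocycle.localRule_mul {G : Type*} [CommGroup G] (C C' : Cocycle 𝔄 G) (r : ℕ)
    (e : Fin D → ℤ) (a : Config D A) (z : Fin D → ℤ) :
    (C * C').localRule r e a z = C.localRule r e a z * C'.localRule r e a z := by
  unfold Cocycle.localRule
  split_ifs
  · rfl
  · exact (mul_one 1).symm

theorem Cocycle.localRule_ofHom (f : Multiplicative (Fin D → ℤ) →* G) (hs : r < s)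
    (u : 𝔄.unflawed a s) {e : Fin D → ℤ} (he : e ∈ unitSteps D) :
    (Cocycle.ofHom 𝔄 f).localRule r e a u = f (Multiplicative.ofAdd e) := by
  obtain ⟨x, hx⟩ := Subshift.exists_realizes (Nat.zero_lt_of_lt hs) u
  exact Cocycle.localRule_eq (Cocycle.isLocallyDetermined_ofHom f r) he x (hx.anti hs.le)

theorem Cocycle.localRule_pullback {Φ : CellularAutomaton D A} {R : ℕ} (hR : Φ.HasRadius R)
    (hΦ : 𝔄.IsInvariant Φ) (hC : C.IsLocallyDetermined r) (hs₀ : 0 < s) (hs : R + r ≤ s)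
    (u : 𝔄.unflawed a s) {e : Fin D → ℤ} (he : e ∈ unitSteps D) :
    C.localRule r e (Φ.toFun a) u = (C.pullback hΦ).localRule (R + r) e a u := by
  obtain ⟨x, hx⟩ := Subshift.exists_realizes hs₀ u
  rw [Cocycle.localRule_eq (hC.pullback hR hΦ) he x (hx.anti hs)]
  exact Cocycle.localRule_eq hC he _ ((hx.anti hs).image hR hΦ)

theorem Cocycle.localRule_of_mem (hC : C.IsLocallyDetermined r) (ha : a ∈ 𝔄.carrier)
    {u v : Fin D → ℤ} (huv : v - u ∈ unitSteps D) :
    C.localRule r (v - u) a u = C.toFun v ⟨a, ha⟩ * (C.toFun u ⟨a, ha⟩)⁻¹ := by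
  rw [Cocycle.localRule_eq hC huv (𝔄.shiftMap u ⟨a, ha⟩) fun i _ => rfl, eq_mul_inv_iff_mul_eq,
    ← C.cocycle_eq, sub_add_cancel]

theorem Cocycle.localRule_transfer {b : 𝔄.carrier → G}
    (hb : ∀ z x, C'.toFun z x = b (𝔄.shiftMap z x) * C.toFun z x * (b x)⁻¹)
    (hbr : Subshift.DependsOnBox b r) (hC : C.IsLocallyDetermined r)
    (hC' : C'.IsLocallyDetermined r) (hs : r < s) {u v : Fin D → ℤ} (huv : v - u ∈ unitSteps D)
    {x y : 𝔄.carrier} (hx : Subshift.Realizes x a u s) (hy : Subshift.Realizes y a v r) :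
    C'.localRule r (v - u) a u = b y * C.localRule r (v - u) a u * (b x)⁻¹ := by
  rw [Cocycle.localRule_eq hC huv x (hx.anti hs.le), Cocycle.localRule_eq hC' huv x (hx.anti hs.le),
    hb, hbr.eq_of_realizes (hx.shiftMap huv hs) hy]

theorem Cocycle.localRule_reverse (hC : C.IsLocallyDetermined r) (hs : r < s)
    (u : 𝔄.unflawed a s) {v : Fin D → ℤ} (huv : v - u ∈ unitSteps D) :
    C.localRule r (u - v) a v = (C.localRule r (v - u) a u)⁻¹ := by
  obtain ⟨x, hx⟩ := Subshift.exists_realizes (Nat.zero_lt_of_lt hs) u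
  have hvu : u - v ∈ unitSteps D := by simpa only [neg_sub] using unitSteps_neg huv
  refine eq_inv_of_mul_eq_one_left ?_
  rw [Cocycle.localRule_two hC hs huv hvu x hx, sub_self, C.map_zero]

end

/-! ### Values along trails -/

section
variable {D : ℕ} {A : Type*} [TopologicalSpace A] {𝔄 : Subshift D A} {a a' : Config D A}
  {G H : Type*} [Group G] [Group H] {C C' : Cocycle 𝔄 G} {r r' s : ℕ}
  {Y Z : Set (Fin D → ℤ)} {x y : Y}

theorem Cocycle.along_conj (β : Y → G)
    (h : ∀ u v : Y, v.1 - u.1 ∈ unitSteps D →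
      C'.localRule r' (v.1 - u.1) a' u = β v * C.localRule r (v.1 - u.1) a u * (β u)⁻¹)
    (p : Trail Y x y) : C'.along r' a' p = β y * C.along r a p * (β x)⁻¹ := by
  induction p with
  | nil => simp only [Cocycle.along, mul_one, mul_inv_cancel]
  | cons huv p ih =>
    rw [Cocycle.along, Cocycle.along, ih, h _ _ huv]
    group

theorem Cocycle.along_congr
    (h : ∀ u v : Y, v.1 - u.1 ∈ unitSteps D →
      C'.localRule r' (v.1 - u.1) a' u = C.localRule r (v.1 - u.1) a u)
    (p : Trail Y x y) : C'.along r' a' p = C.along r a p := by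
  simpa only [one_mul, inv_one, mul_one] using
    Cocycle.along_conj (fun _ => (1 : G)) (fun u v huv => by rw [h u v huv]; group) p

theorem Cocycle.along_eq_of_coboundary (β : Y → G)
    (h : ∀ u v : Y, v.1 - u.1 ∈ unitSteps D → C.localRule r (v.1 - u.1) a u = β v * (β u)⁻¹)
    (p : Trail Y x y) : C.along r a p = β y * (β x)⁻¹ := by
  induction p with
  | nil => exact (mul_inv_cancel _).symm
  | cons huv p ih => rw [Cocycle.along, ih, h _ _ huv, mul_assoc, inv_mul_cancel_left]

theorem Cocycle.along_incl (C : Cocycle 𝔄 G) (r : ℕ) (a : Config D A) (h : Y ⊆ Z)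
    (p : Trail Y x y) : C.along r a (Trail.incl h p) = C.along r a p := by
  induction p with
  | nil => rfl
  | cons _ p ih => exact congrArg (· * _) ih

theorem Cocycle.along_comp (C : Cocycle 𝔄 G) (ψ : G →* H) (r : ℕ) (a : Config D A)
    (p : Trail Y x y) : (C.comp ψ).along r a p = ψ (C.along r a p) := by
  induction p with
  | nil => exact (map_one ψ).symm
  | cons _ p ih => rw [Cocycle.along, Cocycle.along, ih, C.localRule_comp, map_mul]

theorem Cocycle.along_mul {G : Type*} [CommGroup G] (C C' : Cocycle 𝔄 G) (r : ℕ)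
    (a : Config D A) (p : Trail Y x y) :
    (C * C').along r a p = C.along r a p * C'.along r a p := by
  induction p with
  | nil => exact (mul_one 1).symm
  | cons _ p ih =>
    rw [Cocycle.along, Cocycle.along, Cocycle.along, ih, Cocycle.localRule_mul, mul_mul_mul_comm]

theorem Cocycle.along_reverse (hC : C.IsLocallyDetermined r) (hs : r < s)
    {x y : 𝔄.unflawed a s} (p : Trail (𝔄.unflawed a s) x y) :
    C.along r a p.reverse = (C.along r a p)⁻¹ := by
  induction p with
  | nil => exact inv_one.symm
  | @cons u v _ huv p ih =>
    rw [SimpleGraph.Walk.reverse_cons, Cocycle.along_append, ih, Cocycle.along, Cocycle.along,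
      Cocycle.along, one_mul, Cocycle.localRule_reverse hC hs u (v := v.1) huv, mul_inv_rev]

theorem Cocycle.along_pullback {Φ : CellularAutomaton D A} {R : ℕ} (hR : Φ.HasRadius R)
    (hΦ : 𝔄.IsInvariant Φ) (hC : C.IsLocallyDetermined r) (hs₀ : 0 < s) (hs : R + r ≤ s)
    {x y : 𝔄.unflawed a s} (p : Trail (𝔄.unflawed a s) x y) :
    C.along r (Φ.toFun a) p = (C.pullback hΦ).along (R + r) a p :=
  Cocycle.along_congr (fun u _ huv => Cocycle.localRule_pullback hR hΦ hC hs₀ hs u huv) p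

end

/-! ### Residues -/

section
variable {D : ℕ} {A : Type*} [TopologicalSpace A] {𝔄 : Subshift D A} {a : Config D A}
  {G H : Type*} [Group G] [Group H] {C C' : Cocycle 𝔄 G} {r r' s t : ℕ} {x : 𝔄.unflawed a s}

theorem Cocycle.residue_radius (hC : C.IsLocallyDetermined r) (hC' : C.IsLocallyDetermined r')
    (hs : r < s) (hs' : r' < s) (ζ : LoopClass (𝔄.unflawed a s) x) :
    C.residue hC hs a ζ = C.residue hC' hs' a ζ := by
  induction ζ using Quotient.inductionOn with
  | h p => exact Cocycle.along_congr (fun u _ => Cocycle.localRule_radius hC hC' hs hs' u) p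

theorem Cocycle.residue_comp (hC : C.IsLocallyDetermined r) (ψ : G →* H) (hs : r < s)
    (ζ : LoopClass (𝔄.unflawed a s) x) :
    (C.comp ψ).residue (hC.comp ψ) hs a ζ = ψ (C.residue hC hs a ζ) := by
  induction ζ using Quotient.inductionOn with
  | h p => exact C.along_comp ψ r a p

theorem Cocycle.residue_mul {G : Type*} [CommGroup G] {C C' : Cocycle 𝔄 G}
    (hC : C.IsLocallyDetermined r) (hC' : C'.IsLocallyDetermined r) (hs : r < s)
    (ζ : LoopClass (𝔄.unflawed a s) x) :
    (C * C').residue (hC.mul hC') hs a ζ = C.residue hC hs a ζ * C'.residue hC' hs a ζ := by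
  induction ζ using Quotient.inductionOn with
  | h p => exact C.along_mul C' r a p

theorem Cocycle.residue_ofHom (f : Multiplicative (Fin D → ℤ) →* G)
    (hf : (Cocycle.ofHom 𝔄 f).IsLocallyDetermined r) (hs : r < s)
    (ζ : LoopClass (𝔄.unflawed a s) x) : (Cocycle.ofHom 𝔄 f).residue hf hs a ζ = 1 := by
  induction ζ using Quotient.inductionOn with
  | h p =>
    refine (Cocycle.along_eq_of_coboundary (fun u => f (Multiplicative.ofAdd u.1))
      (fun u v huv => ?_) p).trans (mul_inv_cancel _)
    rw [Cocycle.localRule_ofHom f hs u huv, ofAdd_sub, map_div, div_eq_mul_inv]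

theorem Cocycle.residue_of_mem (hC : C.IsLocallyDetermined r) (hs : r < s) (ha : a ∈ 𝔄.carrier)
    (ζ : LoopClass (𝔄.unflawed a s) x) : C.residue hC hs a ζ = 1 := by
  induction ζ using Quotient.inductionOn with
  | h p =>
    exact (Cocycle.along_eq_of_coboundary (fun u => C.toFun u.1 ⟨a, ha⟩)
      (fun _ _ => Cocycle.localRule_of_mem hC ha) p).trans (mul_inv_cancel _)

theorem Cocycle.residue_transfer_isConj {b : 𝔄.carrier → G}
    (hb : ∀ z x, C'.toFun z x = b (𝔄.shiftMap z x) * C.toFun z x * (b x)⁻¹)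
    (hbr : Subshift.DependsOnBox b r) (hC : C.IsLocallyDetermined r)
    (hC' : C'.IsLocallyDetermined r) (hs : r < s) (ζ : LoopClass (𝔄.unflawed a s) x) :
    IsConj (C.residue hC hs a ζ) (C'.residue hC' hs a ζ) := by
  choose ξ hξ using Subshift.exists_realizes (𝔄 := 𝔄) (a := a) (Nat.zero_lt_of_lt hs)
  induction ζ using Quotient.inductionOn with
  | h p =>
    exact isConj_iff.mpr ⟨b (ξ x), (Cocycle.along_conj (fun u => b (ξ u)) (fun u v huv =>
      Cocycle.localRule_transfer hb hbr hC hC' hs huv (hξ u) ((hξ v).anti hs.le)) p).symm⟩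

theorem Cocycle.residue_push_mk_isConj (hC : C.IsLocallyDetermined r) (hs : r < s)
    {Y : Set (Fin D → ℤ)} (h : Y ⊆ 𝔄.unflawed a s) {y : Y}
    (q : Trail (𝔄.unflawed a s) x ⟨y.1, h y.2⟩) (p : Trail Y y y) :
    IsConj (C.residue hC hs a (LoopClass.push h q (Quotient.mk (trailSetoid Y y y) p)))
      (C.along r a p) := by
  change IsConj (C.along r a (q.append ((Trail.incl h p).append q.reverse))) _
  rw [Cocycle.along_append, Cocycle.along_append, Cocycle.along_incl, Cocycle.along_reverse hC hs]
  exact isConj_iff.mpr ⟨C.along r a q, by group⟩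

theorem Cocycle.residue_push_isConj (hC : C.IsLocallyDetermined r) (hs : r < s) (ht : r < t)
    (h : 𝔄.unflawed a t ⊆ 𝔄.unflawed a s) {y : 𝔄.unflawed a t}
    (q : Trail (𝔄.unflawed a s) x ⟨y.1, h y.2⟩) (ζ : LoopClass (𝔄.unflawed a t) y) :
    IsConj (C.residue hC hs a (LoopClass.push h q ζ)) (C.residue hC ht a ζ) := by
  induction ζ using Quotient.inductionOn with
  | h p => exact Cocycle.residue_push_mk_isConj hC hs h q p

variable {Φ : CellularAutomaton D A} {R : ℕ}

theorem Cocycle.residue_image_push_isConj (hR : Φ.HasRadius R) (hΦ : 𝔄.IsInvariant Φ)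
    (hC : C.IsLocallyDetermined r) (hs : r < s)
    {y : 𝔄.unflawed a (R + s)} {z : 𝔄.unflawed (Φ.toFun a) s}
    (q : Trail (𝔄.unflawed (Φ.toFun a) s) z ⟨y.1, Subshift.unflawed_subset hR hΦ a s y.2⟩)
    (ζ : LoopClass (𝔄.unflawed a (R + s)) y) :
    IsConj (C.residue hC hs (Φ.toFun a)
        (LoopClass.push (Subshift.unflawed_subset hR hΦ a s) q ζ))
      ((C.pullback hΦ).residue (hC.pullback hR hΦ) (Nat.add_lt_add_left hs R) a ζ) := by
  induction ζ using Quotient.inductionOn with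
  | h p =>
    have := Cocycle.residue_push_mk_isConj hC hs (Subshift.unflawed_subset hR hΦ a s) q p
    rwa [Cocycle.along_pullback hR hΦ hC (by omega) (by omega)] at this

theorem Cocycle.residue_image_incl (hR : Φ.HasRadius R) (hΦ : 𝔄.IsInvariant Φ)
    (hC : C.IsLocallyDetermined r) (hs : r < s)
    {y : 𝔄.unflawed a (R + s)} (ζ : LoopClass (𝔄.unflawed a (R + s)) y) :
    C.residue hC hs (Φ.toFun a) (LoopClass.incl (Subshift.unflawed_subset hR hΦ a s) ζ) =
      (C.pullback hΦ).residue (hC.pullback hR hΦ) (Nat.add_lt_add_left hs R) a ζ := by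
  induction ζ using Quotient.inductionOn with
  | h p =>
    change C.along r (Φ.toFun a) ((Trail.incl _ p).append .nil) =
      (C.pullback hΦ).along (R + r) a p
    rw [SimpleGraph.Walk.append_nil, Cocycle.along_incl,
      Cocycle.along_pullback hR hΦ hC (by omega) (by omega)]

end

/-! ### Projective residues -/

section
variable {D : ℕ} {A : Type*} [TopologicalSpace A] {𝔄 : Subshift D A} {a : Config D A}
  {ω : ℕ → Fin D → ℤ} {G H : Type*} [Group G] [Group H] {C C' : Cocycle 𝔄 G} {r s t : ℕ}

theorem IsProperRay.mem_slightlyDefective (hω : IsProperRay 𝔄 a ω) : a ∈ 𝔄.slightlyDefective :=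
  ENat.eq_top_iff_forall_ge.mpr fun s =>
    let ⟨N, hN⟩ := hω.eventually_unflawed s
    le_iSup_of_le (ω N) (hN N le_rfl)

theorem IsProperRay.residue_proj_isConj (hω : IsProperRay 𝔄 a ω) (hC : C.IsLocallyDetermined r)
    (hs : r < s) (hst : s ≤ t) (ζ : hω.ProjPi1) :
    IsConj (C.residue hC hs a (ζ.proj s)) (C.residue hC (hs.trans_le hst) a (ζ.proj t)) := by
  induction t, hst using Nat.le_induction with
  | base => exact IsConj.refl _
  | succ t hst ih =>
    refine ih.trans ?_
    rw [← ζ.compat t]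
    exact Cocycle.residue_push_isConj hC _ _ _ _ _

variable [DiscreteTopology A] [Finite A]

theorem IsProperRay.res_isConj_residue (hω : IsProperRay 𝔄 a ω) (hC : C.IsLocallyDetermined r)
    (hs : r < s) (ζ : hω.ProjPi1) : IsConj (hω.res C ζ) (C.residue hC hs a (ζ.proj s)) := by
  classical
  have hC₀ := Nat.find_spec C.exists_isLocallyDetermined
  set r₀ := Nat.find C.exists_isLocallyDetermined
  refine (hω.residue_proj_isConj hC₀ r₀.lt_succ_self (le_max_left (r₀ + 1) s) ζ).trans ?_
  rw [Cocycle.residue_radius hC₀ hC _ (hs.trans_le (le_max_right _ _))]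
  exact (hω.residue_proj_isConj hC hs (le_max_right (r₀ + 1) s) ζ).symm

theorem IsProperRay.res_of_mem (hω : IsProperRay 𝔄 a ω) (ha : a ∈ 𝔄.carrier) (C : Cocycle 𝔄 G)
    (ζ : hω.ProjPi1) : hω.res C ζ = 1 := by
  obtain ⟨r, hC⟩ := C.exists_isLocallyDetermined
  have := hω.res_isConj_residue hC r.lt_succ_self ζ
  rwa [Cocycle.residue_of_mem hC _ ha, isConj_one_left] at this

theorem IsProperRay.res_comp_isConj (hω : IsProperRay 𝔄 a ω) (C : Cocycle 𝔄 G) (ψ : G →* H)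
    (ζ : hω.ProjPi1) : IsConj (hω.res (C.comp ψ) ζ) (ψ (hω.res C ζ)) := by
  obtain ⟨r, hC⟩ := C.exists_isLocallyDetermined
  refine (hω.res_isConj_residue (hC.comp ψ) r.lt_succ_self ζ).trans ?_
  rw [Cocycle.residue_comp]
  exact (ψ.map_isConj (hω.res_isConj_residue hC r.lt_succ_self ζ)).symm

theorem IsProperRay.res_mul {G : Type*} [CommGroup G] (hω : IsProperRay 𝔄 a ω)
    (C C' : Cocycle 𝔄 G) (ζ : hω.ProjPi1) :
    hω.res (C * C') ζ = hω.res C ζ * hω.res C' ζ := by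
  obtain ⟨r, hr⟩ := C.exists_isLocallyDetermined
  obtain ⟨r', hr'⟩ := C'.exists_isLocallyDetermined
  have hC := hr.mono (le_max_left r r')
  have hC' := hr'.mono (le_max_right r r')
  have hs := (max r r').lt_succ_self
  rw [isConj_iff_eq.mp (hω.res_isConj_residue hC hs ζ),
    isConj_iff_eq.mp (hω.res_isConj_residue hC' hs ζ),
    isConj_iff_eq.mp (hω.res_isConj_residue (hC.mul hC') hs ζ), Cocycle.residue_mul]

theorem Cocycle.Cohomologous.res_isConj (h : C.Cohomologous C') (hω : IsProperRay 𝔄 a ω)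
    (ζ : hω.ProjPi1) : IsConj (hω.res C ζ) (hω.res C' ζ) := by
  obtain ⟨b, hb, hbC⟩ := h
  obtain ⟨r₁, h₁⟩ := C.exists_isLocallyDetermined
  obtain ⟨r₂, h₂⟩ := C'.exists_isLocallyDetermined
  obtain ⟨r₃, h₃⟩ := Subshift.exists_dependsOnBox hb
  obtain ⟨r, hr₁, hr₂, hr₃⟩ : ∃ r, r₁ ≤ r ∧ r₂ ≤ r ∧ r₃ ≤ r :=
    ⟨r₁ + r₂ + r₃, by omega, by omega, by omega⟩
  have hC := h₁.mono hr₁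
  have hC' := h₂.mono hr₂
  exact (hω.res_isConj_residue hC r.lt_succ_self ζ).trans <|
    (Cocycle.residue_transfer_isConj hbC (h₃.mono hr₃) hC hC' _ _).trans
      (hω.res_isConj_residue hC' r.lt_succ_self ζ).symm

theorem Cocycle.IsTrivial.res_eq_one (h : C.IsTrivial) (hω : IsProperRay 𝔄 a ω)
    (ζ : hω.ProjPi1) : hω.res C ζ = 1 := by
  obtain ⟨f, hf⟩ := h
  have := (hf.res_isConj hω ζ).trans
    (hω.res_isConj_residue (Cocycle.isLocallyDetermined_ofHom f 0) zero_lt_one ζ)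
  rwa [Cocycle.residue_ofHom, isConj_one_left] at this

theorem IsProperRay.res_imageMap_isConj {Φ : CellularAutomaton D A} {R : ℕ}
    (hω : IsProperRay 𝔄 a ω) (hR : Φ.HasRadius R) (hΦ : 𝔄.IsInvariant Φ) (C : Cocycle 𝔄 G)
    (ζ : hω.ProjPi1) :
    IsConj ((hω.image hR hΦ).res C (hω.imageMap hR hΦ ζ)) (hω.res (C.pullback hΦ) ζ) := by
  obtain ⟨r, hC⟩ := C.exists_isLocallyDetermined
  have hs := r.lt_succ_self
  exact ((hω.image hR hΦ).res_isConj_residue hC hs _).trans <|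
    (Cocycle.residue_image_push_isConj hR hΦ hC hs _ _).trans
      (hω.res_isConj_residue (hC.pullback hR hΦ) (Nat.add_lt_add_left hs R) ζ).symm

end

/-! ### Poles and their persistence -/

section
variable {D : ℕ} {A : Type*} [TopologicalSpace A] [DiscreteTopology A] [Finite A]
  {𝔄 : Subshift D A} {a : Config D A} {ω : ℕ → Fin D → ℤ} {Φ : CellularAutomaton D A} {R : ℕ}
  {hΦ : 𝔄.IsInvariant Φ}

section
variable {G : Type*} [Group G]

theorem HasPole.isDefective (h : HasPole 𝔄 G a ω) : 𝔄.IsDefective a :=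
  let ⟨hω, C, ζ, hne⟩ := h
  ⟨hω.mem_slightlyDefective, fun ha => hne (hω.res_of_mem ha C ζ)⟩

theorem isPersistent_of_hasPole_iterate (h : ∀ t : ℕ, HasPole 𝔄 G (Φ.toFun^[t] a) ω) :
    IsPersistent 𝔄 Φ a :=
  fun t => (h t).isDefective

theorem HasPole.iterate (hΦω : ∀ a, HasPole 𝔄 G a ω → HasPole 𝔄 G (Φ.toFun a) ω)
    (h : HasPole 𝔄 G a ω) (t : ℕ) : HasPole 𝔄 G (Φ.toFun^[t] a) ω := by
  induction t with
  | zero => exact h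
  | succ t ih =>
    rw [Function.iterate_succ_apply']
    exact hΦω _ ih

theorem IsProperRay.hasPole_image_of_res_pullback_ne_one (hω : IsProperRay 𝔄 a ω)
    (hR : Φ.HasRadius R) {C : Cocycle 𝔄 G} {ζ : hω.ProjPi1}
    (h : hω.res (C.pullback hΦ) ζ ≠ 1) : HasPole 𝔄 G (Φ.toFun a) ω :=
  ⟨hω.image hR hΦ, C, hω.imageMap hR hΦ ζ, fun h₁ =>
    h (isConj_one_right.mp (h₁ ▸ hω.res_imageMap_isConj hR hΦ C ζ))⟩

theorem HasPole.image_of_surjective_dynClasses (hR : Φ.HasRadius R)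
    (hsurj : Function.Surjective (DynClasses.map hΦ G)) (h : HasPole 𝔄 G a ω) :
    HasPole 𝔄 G (Φ.toFun a) ω := by
  obtain ⟨hω, C, ζ, hne⟩ := h
  obtain ⟨C', hC'⟩ := hsurj (Quotient.mk _ C)
  induction C' using Quotient.inductionOn with
  | h C' =>
    have hcoh : (C'.pullback hΦ).Cohomologous C := Quotient.exact hC'
    exact hω.hasPole_image_of_res_pullback_ne_one hR fun h₁ =>
      hne (isConj_one_right.mp (h₁ ▸ hcoh.res_isConj hω ζ))

end

theorem HasPole.image_of_surjective_dynCohomology {G : Type*} [CommGroup G] (hR : Φ.HasRadius R)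
    (hsurj : Function.Surjective (DynCohomology.map G hΦ)) (h : HasPole 𝔄 G a ω) :
    HasPole 𝔄 G (Φ.toFun a) ω := by
  obtain ⟨hω, C, ζ, hne⟩ := h
  obtain ⟨C', hC'⟩ := hsurj (QuotientGroup.mk C)
  induction C' using QuotientGroup.induction_on with
  | H C' =>
    have htriv : ((C'.pullback hΦ)⁻¹ * C).IsTrivial := QuotientGroup.eq.mp hC'
    have hmul := hω.res_mul (C'.pullback hΦ) ((C'.pullback hΦ)⁻¹ * C) ζ
    rw [mul_inv_cancel_left, htriv.res_eq_one hω ζ, mul_one] at hmul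
    exact hω.hasPole_image_of_res_pullback_ne_one hR (hmul ▸ hne)

end

/-! ### Fundamental cocycles -/

theorem isConj_iterate_map {M : Type*} [Monoid M] (φ : M →* M) (n : ℕ) {x y : M}
    (h : IsConj x y) : IsConj (φ^[n] x) (φ^[n] y) := by
  induction n generalizing x y with
  | zero => exact h
  | succ _ ih => exact ih (φ.map_isConj h)

section
variable {D : ℕ} {A : Type*} [TopologicalSpace A] {𝔄 : Subshift D A} {a : Config D A}
  {ω : ℕ → Fin D → ℤ} {Φ : CellularAutomaton D A} {R : ℕ} {hΦ : 𝔄.IsInvariant Φ}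

theorem Cocycle.Cohomologous.comp {G H : Type*} [Group G] [Group H] {C C' : Cocycle 𝔄 G}
    (h : C.Cohomologous C') (ψ : G →* H) : (C.comp ψ).Cohomologous (C'.comp ψ) := by
  obtain ⟨b, hb, hbC⟩ := h
  exact ⟨ψ ∘ b, hb.comp ψ, fun z x =>
    (congrArg ψ (hbC z x)).trans (by rw [map_mul, map_mul, map_inv]; rfl)⟩

theorem Cocycle.isInducedEnd_iff {G : Type*} [CommGroup G] {Cs : Cocycle 𝔄 G} {φ : G →* G} :
    Cs.IsInducedEnd hΦ φ ↔ (Cs.pullback hΦ).Cohomologous (Cs.comp φ) :=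
  ⟨fun h => h (MonoidHom.id G), fun h ε => h.comp ε⟩

variable [DiscreteTopology A] [Finite A]

theorem Cocycle.IsFundamental.exists_res_ne_one {G H : Type u} [Group G] [Group H]
    {Cs : Cocycle 𝔄 G} (hCs : Cs.IsFundamental) (hω : IsProperRay 𝔄 a ω)
    (h : HasPole 𝔄 H a ω) : ∃ ζ, hω.res Cs ζ ≠ 1 := by
  obtain ⟨_, C, ζ, hne⟩ := h
  obtain ⟨ψ, hψ⟩ := hCs H C
  refine ⟨ζ, fun h₁ => hne (isConj_one_left.mp ?_)⟩
  simpa only [h₁, map_one] using (hψ.res_isConj hω ζ).trans (hω.res_comp_isConj Cs ψ ζ)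

variable {G : Type*} [Group G] {Cs : Cocycle 𝔄 G} {φ : G →* G}

theorem Cocycle.res_imageMap_isConj_map (hφ : (Cs.pullback hΦ).Cohomologous (Cs.comp φ))
    (hR : Φ.HasRadius R) (hω : IsProperRay 𝔄 a ω) (ζ : hω.ProjPi1) :
    IsConj ((hω.image hR hΦ).res Cs (hω.imageMap hR hΦ ζ)) (φ (hω.res Cs ζ)) :=
  (hω.res_imageMap_isConj hR hΦ Cs ζ).trans <|
    (hφ.res_isConj hω ζ).trans (hω.res_comp_isConj Cs φ ζ)

theorem Cocycle.hasPole_iterate_of_iterate_res_ne_one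
    (hφ : (Cs.pullback hΦ).Cohomologous (Cs.comp φ)) (hR : Φ.HasRadius R)
    (hω : IsProperRay 𝔄 a ω) (h : ∀ n : ℕ, ∃ ζ, φ^[n] (hω.res Cs ζ) ≠ 1) (t : ℕ) :
    HasPole 𝔄 G (Φ.toFun^[t] a) ω := by
  induction t generalizing a with
  | zero =>
    obtain ⟨ζ, hζ⟩ := h 0
    exact ⟨hω, Cs, ζ, hζ⟩
  | succ _ ih =>
    refine ih (hω.image hR hΦ) fun n => ?_
    obtain ⟨ζ, hζ⟩ := h (n + 1)
    refine ⟨hω.imageMap hR hΦ ζ, fun h₁ => hζ (isConj_one_right.mp ?_)⟩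
    have hconj := isConj_iterate_map φ n (Cocycle.res_imageMap_isConj_map hφ hR hω ζ)
    rwa [h₁] at hconj

theorem Cocycle.hasPole_iterate_of_injective (hφ : (Cs.pullback hΦ).Cohomologous (Cs.comp φ))
    (hinj : Function.Injective φ) (hR : Φ.HasRadius R) (hω : IsProperRay 𝔄 a ω)
    {ζ : hω.ProjPi1} (hζ : hω.res Cs ζ ≠ 1) (t : ℕ) : HasPole 𝔄 G (Φ.toFun^[t] a) ω :=
  Cocycle.hasPole_iterate_of_iterate_res_ne_one hφ hR hω
    (fun n => ⟨ζ, fun h => hζ (hinj.iterate n (h.trans (iterate_map_one φ n).symm))⟩) t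

end

theorem proposition2p8_general {D : ℕ} {A : Type v} [TopologicalSpace A] [DiscreteTopology A]
    [Finite A] (𝔄 : Subshift D A) (Φ : CellularAutomaton D A) (R : ℕ)
    (hR : Φ.HasRadius R) (hΦ : 𝔄.IsInvariant Φ) (a : Config D A) :
    (∀ (G : Type u) [Group G] (C : Cocycle 𝔄 G) (r : ℕ) (_ : 0 < r)
        (hC : C.IsLocallyDetermined r),
      𝔄.unflawed a (R + r) ⊆ 𝔄.unflawed (Φ.toFun a) r ∧
      ∃ hC' : (C.pullback hΦ).IsLocallyDetermined (R + r),
        (∀ (x y : 𝔄.unflawed a (R + r)) (ζ : Trail (𝔄.unflawed a (R + r)) x y),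
          C.along r (Φ.toFun a) ζ = (C.pullback hΦ).along (R + r) a ζ) ∧
        (∀ (s : ℕ) (hs : r < s) (x : 𝔄.unflawed a (R + s))
            (ζ : LoopClass (𝔄.unflawed a (R + s)) x),
          C.residue hC hs (Φ.toFun a) (LoopClass.incl (Subshift.unflawed_subset hR hΦ a s) ζ) =
            (C.pullback hΦ).residue hC' (Nat.add_lt_add_left hs R) a ζ)) ∧
    (∀ (G : Type u) [Group G], Function.Surjective (DynClasses.map hΦ G) →
      ∀ ω, HasPole 𝔄 G a ω →
        IsPersistent 𝔄 Φ a ∧ ∀ t : ℕ, HasPole 𝔄 G (Φ.toFun^[t] a) ω) ∧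
    (∀ (G : Type u) [CommGroup G], Function.Surjective (DynCohomology.map G hΦ) →
      ∀ ω, HasPole 𝔄 G a ω →
        IsPersistent 𝔄 Φ a ∧ ∀ t : ℕ, HasPole 𝔄 G (Φ.toFun^[t] a) ω) ∧
    (∀ (Gs : Type u) [Group Gs] (Cs : Cocycle 𝔄 Gs), Cs.IsFundamental →
      (∀ (H : Type u) [Group H] (ω : ℕ → Fin D → ℤ) (hω : IsProperRay 𝔄 a ω),
        HasPole 𝔄 H a ω → ∃ ζ, hω.res Cs ζ ≠ 1) ∧
      (∃ φ : Gs →* Gs, (Cs.pullback hΦ).Cohomologous (Cs.comp φ)) ∧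
      (∀ φ : Gs →* Gs, (Cs.pullback hΦ).Cohomologous (Cs.comp φ) →
        (∀ (ω : ℕ → Fin D → ℤ) (hω : IsProperRay 𝔄 a ω) (ζ : hω.ProjPi1),
          IsConj ((hω.image hR hΦ).res Cs (hω.imageMap hR hΦ ζ)) (φ (hω.res Cs ζ))) ∧
        (∀ (ω : ℕ → Fin D → ℤ) (hω : IsProperRay 𝔄 a ω),
          (∀ n : ℕ, ∃ ζ, φ^[n] (hω.res Cs ζ) ≠ 1) → IsPersistent 𝔄 Φ a) ∧
        (Function.Injective φ →
          ∀ (H : Type u) [Group H] (ω : ℕ → Fin D → ℤ), HasPole 𝔄 H a ω →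
            IsPersistent 𝔄 Φ a ∧ ∀ t : ℕ, HasPole 𝔄 Gs (Φ.toFun^[t] a) ω))) := by
  refine ⟨fun G _ C r hr hC => ⟨Subshift.unflawed_subset hR hΦ a r, hC.pullback hR hΦ,
      fun _ _ => Cocycle.along_pullback hR hΦ hC (by omega) le_rfl,
      fun _ hs _ => Cocycle.residue_image_incl hR hΦ hC hs⟩,
    fun G _ hsurj ω hpole => ?_, fun G _ hsurj ω hpole => ?_, fun Gs _ Cs hCs =>
      ⟨fun H _ ω hω => hCs.exists_res_ne_one hω, hCs Gs (Cs.pullback hΦ), fun φ hφ =>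
        ⟨fun ω => Cocycle.res_imageMap_isConj_map hφ hR, fun ω hω hne => ?_,
          fun hinj H _ ω hpole => ?_⟩⟩⟩
  · have := hpole.iterate fun _ => HasPole.image_of_surjective_dynClasses hR hsurj
    exact ⟨isPersistent_of_hasPole_iterate this, this⟩
  · have := hpole.iterate fun _ => HasPole.image_of_surjective_dynCohomology hR hsurj
    exact ⟨isPersistent_of_hasPole_iterate this, this⟩
  · exact isPersistent_of_hasPole_iterate
      (Cocycle.hasPole_iterate_of_iterate_res_ne_one hφ hR hω hne)
  · obtain ⟨hω, -⟩ := id hpole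
    obtain ⟨ζ, hζ⟩ := hCs.exists_res_ne_one hω hpole
    have := Cocycle.hasPole_iterate_of_injective hφ hinj hR hω hζ
    exact ⟨isPersistent_of_hasPole_iterate this, this⟩

theorem proposition2p8 {D : ℕ} {A : Type v} [TopologicalSpace A] [DiscreteTopology A]
    [Finite A] (𝔄 : Subshift D A) (Φ : CellularAutomaton D A) (R : ℕ) (hR0 : 0 < R)
    (hR : Φ.HasRadius R) (hΦ : 𝔄.IsInvariant Φ) (a : Config D A) (ha : a ∈ 𝔄.slightlyDefective) :
    -- transformation of residues
    (∀ (G : Type u) [Group G] (C : Cocycle 𝔄 G) (r : ℕ) (hr0 : 0 < r)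
        (hC : C.IsLocallyDetermined r),
      𝔄.unflawed a (R + r) ⊆ 𝔄.unflawed (Φ.toFun a) r ∧
      ∃ hC' : (C.pullback hΦ).IsLocallyDetermined (R + r),
        (∀ (x y : 𝔄.unflawed a (R + r)) (ζ : Trail (𝔄.unflawed a (R + r)) x y),
          C.along r (Φ.toFun a) ζ = (C.pullback hΦ).along (R + r) a ζ) ∧
        (∀ (s : ℕ) (hs : r < s) (x : 𝔄.unflawed a (R + s))
            (ζ : LoopClass (𝔄.unflawed a (R + s)) x),
          C.residue hC hs (Φ.toFun a) (LoopClass.incl (Subshift.unflawed_subset hR hΦ a s) ζ) =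
            (C.pullback hΦ).residue hC' (Nat.add_lt_add_left hs R) a ζ)) ∧
    -- persistence of poles when the induced map on cohomology is surjective,
    -- first for cohomology classes in an arbitrary group, then for abelian cohomology groups
    (∀ (G : Type u) [Group G], Function.Surjective (DynClasses.map hΦ G) →
      ∀ ω, HasPole 𝔄 G a ω →
        IsPersistent 𝔄 Φ a ∧ ∀ t : ℕ, HasPole 𝔄 G (Φ.toFun^[t] a) ω) ∧
    (∀ (G : Type u) [CommGroup G], Function.Surjective (DynCohomology.map G hΦ) →
      ∀ ω, HasPole 𝔄 G a ω →
        IsPersistent 𝔄 Φ a ∧ ∀ t : ℕ, HasPole 𝔄 G (Φ.toFun^[t] a) ω) ∧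
    -- consequences of an abelian fundamental cocycle
    (∀ (Gs : Type u) [CommGroup Gs] (Cs : Cocycle 𝔄 Gs), Cs.IsFundamental →
      (∀ (H : Type u) [CommGroup H] (ω : ℕ → Fin D → ℤ) (hω : IsProperRay 𝔄 a ω),
        HasPole 𝔄 H a ω → ∃ ζ, hω.res Cs ζ ≠ 1) ∧
      (∃ φ : Gs →* Gs, Cs.IsInducedEnd hΦ φ) ∧
      (∀ φ : Gs →* Gs, Cs.IsInducedEnd hΦ φ →
        (∀ (ω : ℕ → Fin D → ℤ) (hω : IsProperRay 𝔄 a ω) (ζ : hω.ProjPi1),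
          (hω.image hR hΦ).res Cs (hω.imageMap hR hΦ ζ) = φ (hω.res Cs ζ)) ∧
        (∀ (ω : ℕ → Fin D → ℤ) (hω : IsProperRay 𝔄 a ω),
          (∀ n : ℕ, ∃ ζ, φ^[n] (hω.res Cs ζ) ≠ 1) → IsPersistent 𝔄 Φ a) ∧
        (Function.Injective φ →
          ∀ (H : Type u) [Group H] (ω : ℕ → Fin D → ℤ), HasPole 𝔄 H a ω →
            IsPersistent 𝔄 Φ a ∧ ∀ t : ℕ, HasPole 𝔄 Gs (Φ.toFun^[t] a) ω))) := by
  obtain ⟨residues, classes, cohomology, fundamental⟩ := proposition2p8_general 𝔄 Φ R hR hΦ a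
  refine ⟨residues, classes, cohomology, fun Gs _ Cs hCs => ?_⟩
  obtain ⟨detects, induced⟩ := fundamental Gs Cs hCs
  simp only [isConj_iff_eq] at induced
  simp only [Cocycle.isInducedEnd_iff]
  exact ⟨fun H _ => detects H, induced⟩
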